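/- Write points of $\mathbf R^4$ as $(x,y,u,v)$ and let $\omega=dx\wedge du+dy\wedge dv$. A \emph{Lagrangean surface} is the image of a smooth immersion of a surface into $\mathbf R^4$ that pulls $\omega$ back to $0$; a surface in $\mathbf R^4$ is an \emph{L-surface} if some isometry of $\mathbf R^4$ (possibly orientation reversing) maps it onto a Lagrangean surface. For an immersed surface $\Xi(x,y)$ let $p_{ij}$ be the Plücker coordinates of $\Xi_x\wedge\Xi_y/|\Xi_x\wedge\Xi_y|$. Its Gauss map is $\Gamma=(p_{12},p_{13},p_{14},p_{34},p_{42},p_{23})$, with the spherical components $\Gamma_1=(a_1,a_2,a_3)=(p_{12}+p_{34},p_{13}+p_{42},p_{14}+p_{23})$ and $\Gamma_2=(b_1,b_2,b_3)=(p_{12}-p_{34},p_{13}-p_{42},p_{14}-p_{23})$, which take values in the unit sphere $\mathbf S^2\subset\mathbf R^3$. If $(e_1,e_2,e_3,e_4)$ is a positively oriented orthonormal frame with $e_1,e_2$ tangent, and the second fundamental form is $(a u_1^2+2b u_1u_2+c u_2^2)e_3+(e u_1^2+2f u_1u_2+g u_2^2)e_4$, then the Gaussian and the normal curvature are $K=(ac-b^2)+(eg-f^2)$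 and $\kappa=(a-c)f-(e-g)b$. A unit tangent vector $w$ at a point with oriented tangent plane $P$ spans an \emph{isoclinic direction} if it is the velocity of a curve on the surface along which the velocity of the tangent plane (in Plücker coordinates) is tangent at $P$ to one of the sets of oriented planes $\{P' : a(P')=a(P)\}$, $\{P' : b(P')=b(P)\}$. The surface is \emph{isoclinic} if it has an isoclinic direction at every point. \textbf{Statement.} There are a connected open neighbourhood $U$ of the origin in $\mathbf R^2$ and a $C^\infty$ function $\phi:U\to\mathbf R$ with \[ 1-y\phi_x+x\phi_y=\tfrac1{\sqrt2}\sqrt{1+\phi_x^2+\phi_y^2+x^2+y^2+(y\phi_x-x\phi_y)^2}\quad\text{on }U, \] with $\phi(x,0)=-x^2/2$ whenever $(x,0)\in U$, and with $\phi_y(0,0)=-1$, such that the surface \[ S=\{(x,y,\phi(x,y),\tfrac12(x^2+y^2)) : (x,y)\in U\}, \] parametrized by $(x,y)\in U$, is a smooth immersed surface with the following properties: \begin{itemize} \item the image of $\Gamma_2$ is contained in the small circle $b_1=1/\sqrt2$ of $\mathbf S^2$; \item $\Gamma_1$ is an immersion, and neither the image of $\Gamma_1$ nor the image of $\Gamma_2$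 is contained in a great circle; \item $K=\kappa$ at every point of $S$ (in every frame as above, and such frames exist at every point), and $S$ is isoclinic; \item $S$ is not an L-surface. \end{itemize} In particular, $|K|\equiv|\kappa|$ does not imply that a surface is an L-surface. -/

import Mathlib

open scoped ContDiff Topology

noncomputable section

namespace SurfR4

/-- Euclidean four-space, with coordinates `(x, y, u, v)`. -/
abbrev R4 := EuclideanSpace ℝ (Fin 4)

/-- The space of Plücker coordinates `(p₁₂, p₁₃, p₁₄, p₃₄, p₄₂, p₂₃)`. -/
abbrev R6 := EuclideanSpace ℝ (Fin 6)

/-- The space containing the two spheres of Klein coordinates. -/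
abbrev R3 := EuclideanSpace ℝ (Fin 3)

/-! ### Parametrized surfaces -/

/-- `Ξ` restricted to the open set `U` is a smooth immersion. -/
structure IsImmersedOn (Ξ : ℝ × ℝ → R4) (U : Set (ℝ × ℝ)) : Prop where
  isOpen : IsOpen U
  smooth : ContDiffOn ℝ ∞ Ξ U
  immersion : ∀ q ∈ U, Function.Injective (fderiv ℝ Ξ q)

/-- Partial derivative with respect to the first variable. -/
def dx {F : Type*} [NormedAddCommGroup F] [NormedSpace ℝ F] (f : ℝ × ℝ → F) (q : ℝ × ℝ) : F :=
  fderiv ℝ f q (1, 0)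

/-- Partial derivative with respect to the second variable. -/
def dy {F : Type*} [NormedAddCommGroup F] [NormedSpace ℝ F] (f : ℝ × ℝ → F) (q : ℝ × ℝ) : F :=
  fderiv ℝ f q (0, 1)

/-- The graph parametrization `(x, y) ↦ (x, y, φ(x, y), ψ(x, y))`. -/
def graphMap (φ ψ : ℝ × ℝ → ℝ) (q : ℝ × ℝ) : R4 := !₂[q.1, q.2, φ q, ψ q]

/-! ### Gaussian and normal curvature through adapted frames -/

/-- `e` is a positively oriented orthonormal basis of `ℝ⁴` whose first two vectors span the
tangent plane of `Ξ` at `q` (so that the last two span the normal plane); `w 0`, `w 1` are the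
parameter vectors that represent the tangent vectors `e 0`, `e 1`. -/
structure IsAdaptedFrame (Ξ : ℝ × ℝ → R4) (q : ℝ × ℝ) (e : Fin 4 → R4) (w : Fin 2 → ℝ × ℝ) :
    Prop where
  orthonormal : Orthonormal ℝ e
  positive : 0 < (Matrix.of fun i j : Fin 4 => e j i).det
  tangent_zero : fderiv ℝ Ξ q (w 0) = e 0
  tangent_one : fderiv ℝ Ξ q (w 1) = e 1

/-- The second fundamental form in the normal direction `n`, on the tangent vectors
represented by the parameter vectors `w₁`, `w₂`. -/
def sff (Ξ : ℝ × ℝ → R4) (q : ℝ × ℝ) (n : R4) (w₁ w₂ : ℝ × ℝ) : ℝ :=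
  inner ℝ (fderiv ℝ (fderiv ℝ Ξ) q w₁ w₂) n

/-- Gaussian curvature `(ac - b²) + (eg - f²)`, where `a, b, c` and `e, f, g` are the
coefficients of the second fundamental form along the third and the fourth frame vector. -/
def gaussCurvature (Ξ : ℝ × ℝ → R4) (q : ℝ × ℝ) (e : Fin 4 → R4) (w : Fin 2 → ℝ × ℝ) : ℝ :=
  (sff Ξ q (e 2) (w 0) (w 0) * sff Ξ q (e 2) (w 1) (w 1) - sff Ξ q (e 2) (w 0) (w 1) ^ 2) +
  (sff Ξ q (e 3) (w 0) (w 0) * sff Ξ q (e 3) (w 1) (w 1) - sff Ξ q (e 3) (w 0) (w 1) ^ 2)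

/-- Normal curvature `(a - c) f - (e - g) b`. -/
def normalCurvature (Ξ : ℝ × ℝ → R4) (q : ℝ × ℝ) (e : Fin 4 → R4) (w : Fin 2 → ℝ × ℝ) : ℝ :=
  (sff Ξ q (e 2) (w 0) (w 0) - sff Ξ q (e 2) (w 1) (w 1)) * sff Ξ q (e 3) (w 0) (w 1) -
  (sff Ξ q (e 3) (w 0) (w 0) - sff Ξ q (e 3) (w 1) (w 1)) * sff Ξ q (e 2) (w 0) (w 1)

/-! ### The Gauss map -/

/-- The bivector `v ∧ w` in the coordinates `(p₁₂, p₁₃, p₁₄, p₃₄, p₄₂, p₂₃)`. -/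
def wedge (v w : R4) : R6 :=
  !₂[v 0 * w 1 - v 1 * w 0, v 0 * w 2 - v 2 * w 0, v 0 * w 3 - v 3 * w 0,
     v 2 * w 3 - v 3 * w 2, v 3 * w 1 - v 1 * w 3, v 1 * w 2 - v 2 * w 1]

/-- The Grassmannian of oriented planes in `ℝ⁴`: the unit vectors of `ℝ⁶` that satisfy the
Plücker relation. -/
def grassmannian : Set R6 :=
  {P | ‖P‖ = 1 ∧ P 0 * P 3 + P 1 * P 4 + P 2 * P 5 = 0}

/-- Klein coordinates `a` of an oriented plane. -/
def kleinA (P : R6) : R3 := !₂[P 0 + P 3, P 1 + P 4, P 2 + P 5]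

/-- Klein coordinates `b` of an oriented plane. -/
def kleinB (P : R6) : R3 := !₂[P 0 - P 3, P 1 - P 4, P 2 - P 5]

/-- The Gauss map in Plücker coordinates: the tangent plane oriented by `(Ξ_x, Ξ_y)`. -/
def gaussMap (Ξ : ℝ × ℝ → R4) (q : ℝ × ℝ) : R6 :=
  ‖wedge (dx Ξ q) (dy Ξ q)‖⁻¹ • wedge (dx Ξ q) (dy Ξ q)

/-- The first spherical component of the Gauss map. -/
def gauss₁ (Ξ : ℝ × ℝ → R4) (q : ℝ × ℝ) : R3 := kleinA (gaussMap Ξ q)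

/-- The second spherical component of the Gauss map. -/
def gauss₂ (Ξ : ℝ × ℝ → R4) (q : ℝ × ℝ) : R3 := kleinB (gaussMap Ξ q)

/-- The circle `b₁ = c` on the unit sphere. -/
def sphereCircle (c : ℝ) : Set R3 := {b | ‖b‖ = 1 ∧ b 0 = c}

/-- A subset of the unit sphere is contained in a great circle: it lies in a plane through
the origin. -/
def InGreatCircle (s : Set R3) : Prop := ∃ n : R3, n ≠ 0 ∧ ∀ b ∈ s, inner ℝ n b = 0

/-! ### Isoclinic surfaces -/

/-- The sheet of type `+` of the isocline surface of the plane `P`. -/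
def isoclinePlus (P : R6) : Set R6 := {P' | P' ∈ grassmannian ∧ kleinA P' = kleinA P}

/-- The sheet of type `-` of the isocline surface of the plane `P`. -/
def isoclineMinus (P : R6) : Set R6 := {P' | P' ∈ grassmannian ∧ kleinB P' = kleinB P}

/-- Tangent vectors at `P` to `M ⊆ ℝ⁶`: the velocities of the curves in `M` through `P`. -/
def tangentVectors (M : Set R6) (P : R6) : Set R6 :=
  {v | ∃ c : ℝ → R6, (∀ᶠ t in 𝓝 (0 : ℝ), c t ∈ M) ∧ c 0 = P ∧ HasDerivAt c v 0}

/-- The unit tangent vector `u` at `Ξ q` is the velocity of a curve `Ξ ∘ γ` on the surface along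
which the velocity of the tangent plane is tangent to the sheet `I P` of the isocline surface of
the tangent plane `P` at `Ξ q`. -/
def IsIsoclinicDirection (I : R6 → Set R6) (Ξ : ℝ × ℝ → R4) (q : ℝ × ℝ) (u : R4) : Prop :=
  ‖u‖ = 1 ∧ ∃ γ : ℝ → ℝ × ℝ, ContDiffAt ℝ ∞ γ 0 ∧ γ 0 = q ∧ HasDerivAt (Ξ ∘ γ) u 0 ∧
    ∃ P' ∈ tangentVectors (I (gaussMap Ξ q)) (gaussMap Ξ q), HasDerivAt (gaussMap Ξ ∘ γ) P' 0

/-- There is an isoclinic direction, of type `+` or `-`, at every point of the surface. -/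
def IsIsoclinicSurface (Ξ : ℝ × ℝ → R4) (U : Set (ℝ × ℝ)) : Prop :=
  ∀ q ∈ U, ∃ u : R4,
    IsIsoclinicDirection isoclinePlus Ξ q u ∨ IsIsoclinicDirection isoclineMinus Ξ q u

/-! ### Lagrangean surfaces and L-surfaces -/

/-- The standard symplectic form `dx ∧ du + dy ∧ dv`. -/
def sympl (v w : R4) : ℝ := (v 0 * w 2 - v 2 * w 0) + (v 1 * w 3 - v 3 * w 1)

/-- `L` is an immersed Lagrangean surface: the image of a smooth immersion, of an open subset
of the plane that need not be connected, which pulls the symplectic form back to zero. -/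
def IsLagrangeanSurface (L : Set R4) : Prop :=
  ∃ (V : Set (ℝ × ℝ)) (Λ : ℝ × ℝ → R4), IsImmersedOn Λ V ∧ L = Λ '' V ∧
    ∀ q ∈ V, ∀ w₁ w₂ : ℝ × ℝ, sympl (fderiv ℝ Λ q w₁) (fderiv ℝ Λ q w₂) = 0

/-- `S` is congruent, by an isometry of `ℝ⁴` that may reverse the orientation, to a Lagrangean
surface. -/
def IsLSurface (S : Set R4) : Prop :=
  ∃ A : R4 ≃ᵃⁱ[ℝ] R4, IsLagrangeanSurface (A '' S)

/-- The function `(x² + y²) / 2`. -/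
def halfSq (q : ℝ × ℝ) : ℝ := (q.1 ^ 2 + q.2 ^ 2) / 2

end SurfR4

end

/-!
The squared equation reads `p² + q² + x² + y² = 1 + 4 m + m²` with `p = φ_x`, `q = φ_y` and
`m = x q - y p`. Its Hamiltonian is that of a harmonic oscillator minus a function of the angular
momentum `m`, which Poisson-commutes with the oscillator. Hence the characteristics are explicit:
they are oscillator trajectories, turned with an angular velocity that is constant along each of
them. The strip over the axis `y = 0` is determined by the initial condition (`initSlope`), and the
primitive of `p dx + q dy` along the characteristics is explicit as well (`charU`). As the
characteristics through the axis cover a neighbourhood of the origin diffeomorphically, this gives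
a solution `φ`; all the data are analytic, so it suffices to work with germs at the origin
(`exists_isSolutionGerm`).

For the graph, `Ξ_x ∧ Ξ_y` has Klein coordinates `(1 - m, q + x, y - p)` and `(1 + m, q - x, y + p)`
(`gauss_graphMap`), and the equation says that its norm is `√2 (1 + m)`, that is, that `Γ₂` lies on
the circle `b₁ = 1/√2`. So `dΓ₂` has a kernel at every point (`exists_fderiv_gauss₂_eq_zero`). A
direction in this kernel is isoclinic. Moreover `K - κ` is up to sign the Jacobian of `Γ₂`, so it
vanishes (`gaussCurvature_eq_normalCurvature`). The statements about the spherical images are read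
off from the second derivatives of `φ` at the origin.

Finally, a surface is Lagrangean when its tangent planes are orthogonal to the bivector of the
symplectic form. The image of that bivector under an isometry is still self-dual or anti-self-dual
(`exists_bivector_sympl_comp`), so one of the two spherical images of an L-surface lies on a great
circle (`inGreatCircle_of_isLSurface`), which is not the case here.
-/

open scoped ContDiff Topology

namespace SurfR4

/-! ### Solving the equation along its characteristics -/

/-- The value of `φ_y` at `(s, 0)` that the equation forces on a solution with
`φ(x, 0) = -x² / 2` and `φ_y(0, 0) = -1`. -/
noncomputable def initSlope (s : ℝ) : ℝ := (2 * s - √(1 + s ^ 2 + 2 * s ^ 4)) / (1 - s ^ 2)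

lemma initSlope_eq {s : ℝ} (hs : 1 - s ^ 2 ≠ 0) :
    initSlope s ^ 2 * (1 - s ^ 2) - 4 * s * initSlope s + 2 * s ^ 2 - 1 = 0 := by
  have hR : √(1 + s ^ 2 + 2 * s ^ 4) ^ 2 = 1 + s ^ 2 + 2 * s ^ 4 := Real.sq_sqrt (by positivity)
  unfold initSlope
  generalize √(1 + s ^ 2 + 2 * s ^ 4) = R at hR
  field_simp
  linear_combination hR

lemma contDiffAt_initSlope {s : ℝ} (hs : 1 - s ^ 2 ≠ 0) : ContDiffAt ℝ ω initSlope s := by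
  unfold initSlope
  refine ContDiffAt.div (ContDiffAt.sub (by fun_prop) (ContDiffAt.sqrt (by fun_prop) ?_))
    (by fun_prop) hs
  positivity

/-- The angular momentum `x φ_y - y φ_x` along the characteristic through `(s, 0)`. -/
noncomputable def angMom (s : ℝ) : ℝ := s * initSlope s

/-- The angle by which the harmonic oscillator is turned at the parameter `(s, t)`. -/
noncomputable def charAngle (σ : ℝ × ℝ) : ℝ := (4 + 2 * angMom σ.1) * σ.2

/-- The `x`-coordinate at time `t` of the characteristic through `(s, 0)`. In complex notation, with
`θ = charAngle (s, t)` and `k = initSlope s`, the point is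
`x + i y = exp (-i θ) (s cos 2t + (-s + i k) sin 2t)` and the gradient is
`p + i q = exp (-i θ) ((-s + i k) cos 2t - s sin 2t)`. -/
noncomputable def charX (σ : ℝ × ℝ) : ℝ :=
  Real.cos (charAngle σ) * (σ.1 * Real.cos (2 * σ.2) - σ.1 * Real.sin (2 * σ.2)) +
    Real.sin (charAngle σ) * (initSlope σ.1 * Real.sin (2 * σ.2))

/-- The `y`-coordinate at time `t` of the characteristic through `(s, 0)`. -/
noncomputable def charY (σ : ℝ × ℝ) : ℝ :=
  Real.cos (charAngle σ) * (initSlope σ.1 * Real.sin (2 * σ.2)) -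
    Real.sin (charAngle σ) * (σ.1 * Real.cos (2 * σ.2) - σ.1 * Real.sin (2 * σ.2))

/-- The value of `φ_x` at time `t` on the characteristic through `(s, 0)`. -/
noncomputable def charP (σ : ℝ × ℝ) : ℝ :=
  Real.cos (charAngle σ) * (-σ.1 * Real.cos (2 * σ.2) - σ.1 * Real.sin (2 * σ.2)) +
    Real.sin (charAngle σ) * (initSlope σ.1 * Real.cos (2 * σ.2))

/-- The value of `φ_y` at time `t` on the characteristic through `(s, 0)`. -/
noncomputable def charQ (σ : ℝ × ℝ) : ℝ :=
  Real.cos (charAngle σ) * (initSlope σ.1 * Real.cos (2 * σ.2)) -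
    Real.sin (charAngle σ) * (-σ.1 * Real.cos (2 * σ.2) - σ.1 * Real.sin (2 * σ.2))

/-- The value of `φ` at time `t` on the characteristic through `(s, 0)`: the integral of
`p dx + q dy`, starting from `φ(s, 0) = -s² / 2`. -/
noncomputable def charU (σ : ℝ × ℝ) : ℝ :=
  -σ.1 ^ 2 / 2 + (1 - angMom σ.1 ^ 2) * σ.2 +
    initSlope σ.1 ^ 2 * Real.sin (2 * σ.2) * Real.cos (2 * σ.2) / 2 +
    σ.1 ^ 2 * Real.sin (2 * σ.2) ^ 2

/-- The angular momentum is conserved along the characteristics. -/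
lemma charX_mul_charQ_sub (σ : ℝ × ℝ) :
    charX σ * charQ σ - charY σ * charP σ = angMom σ.1 := by
  have h1 := Real.sin_sq_add_cos_sq (charAngle σ)
  have h2 := Real.sin_sq_add_cos_sq (2 * σ.2)
  unfold charX charQ charY charP angMom
  generalize Real.sin (charAngle σ) = D at *
  generalize Real.cos (charAngle σ) = C at *
  generalize Real.sin (2 * σ.2) = S at *
  generalize Real.cos (2 * σ.2) = c at *
  linear_combination (σ.1 * initSlope σ.1) * ((S ^ 2 + c ^ 2) * h1 + h2)

/-- The squared equation holds along the characteristics. -/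
lemma char_sq_equation {σ : ℝ × ℝ} (hs : 1 - σ.1 ^ 2 ≠ 0) :
    charP σ ^ 2 + charQ σ ^ 2 + charX σ ^ 2 + charY σ ^ 2 =
      1 + 4 * angMom σ.1 + angMom σ.1 ^ 2 := by
  have h1 := Real.sin_sq_add_cos_sq (charAngle σ)
  have h2 := Real.sin_sq_add_cos_sq (2 * σ.2)
  have h3 := initSlope_eq hs
  unfold charX charQ charY charP angMom
  generalize Real.sin (charAngle σ) = D at *
  generalize Real.cos (charAngle σ) = C at *
  generalize Real.sin (2 * σ.2) = S at *
  generalize Real.cos (2 * σ.2) = c at *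
  generalize initSlope σ.1 = k at *
  linear_combination (2 * σ.1 ^ 2 + k ^ 2) * ((S ^ 2 + c ^ 2) * h1 + h2) + h3

/-- Along a characteristic, Hamilton's equations hold for the variables, and `charU` is a primitive
of `p dx + q dy`. -/
lemma char_hasDerivAt_time {s t : ℝ} (hs : 1 - s ^ 2 ≠ 0) :
    ∃ x' y' u' : ℝ, HasDerivAt (fun t => charX (s, t)) x' t ∧
      HasDerivAt (fun t => charY (s, t)) y' t ∧ HasDerivAt (fun t => charU (s, t)) u' t ∧
      u' = charP (s, t) * x' + charQ (s, t) * y' ∧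
      x' = 2 * charP (s, t) + (4 + 2 * angMom s) * charY (s, t) ∧
      y' = 2 * charQ (s, t) - (4 + 2 * angMom s) * charX (s, t) := by
  have hθ : HasDerivAt (fun t => charAngle (s, t)) (4 + 2 * angMom s) t := by
    simpa [charAngle] using (hasDerivAt_id t).const_mul (4 + 2 * angMom s)
  have h2 : HasDerivAt (fun t : ℝ => 2 * t) 2 t := by
    simpa using (hasDerivAt_id t).const_mul 2
  have hC := hθ.cos
  have hD := hθ.sin
  have hc := h2.cos
  have hS := h2.sin
  have hA := (hc.const_mul s).sub (hS.const_mul s)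
  have hB := hS.const_mul (initSlope s)
  have hx := (hC.mul hA).add (hD.mul hB)
  have hy := (hC.mul hB).sub (hD.mul hA)
  have hu := ((((hasDerivAt_id t).const_mul (1 - angMom s ^ 2)).const_add (-s ^ 2 / 2)).add
    (((hS.const_mul (initSlope s ^ 2)).mul hc).div_const 2)).add
    ((hS.pow 2).const_mul (s ^ 2))
  refine ⟨_, _, _, hx, hy, hu, ?_, ?_, ?_⟩
  · have h1 := Real.sin_sq_add_cos_sq (charAngle (s, t))
    have h2 := Real.sin_sq_add_cos_sq (2 * t)
    have h3 := initSlope_eq hs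
    simp only [charP, charQ, angMom, Pi.sub_apply]
    generalize Real.sin (charAngle (s, t)) = D at *
    generalize Real.cos (charAngle (s, t)) = C at *
    generalize Real.sin (2 * t) = S at *
    generalize Real.cos (2 * t) = c at *
    generalize initSlope s = k at *
    linear_combination -(2 * (s * c + s * S) ^ 2 + 2 * (k * c) ^ 2 - (4 + 2 * (s * k)) *
      ((s * c - s * S) * (k * c) + k * S * (s * c + s * S))) * h1 -
      (2 * s ^ 2 + k ^ 2 - (4 + 2 * (s * k)) * (s * k)) * h2 - h3
  · simp only [charP, charY, Pi.sub_apply]; ring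
  · simp only [charQ, charX, Pi.sub_apply]; ring

/-- Also across the characteristics `charU` is a primitive of `p dx + q dy`. -/
lemma char_hasDerivAt_init {s t : ℝ} (hs : 1 - s ^ 2 ≠ 0) :
    ∃ x' y' u' : ℝ, HasDerivAt (fun s => charX (s, t)) x' s ∧
      HasDerivAt (fun s => charY (s, t)) y' s ∧ HasDerivAt (fun s => charU (s, t)) u' s ∧
      u' = charP (s, t) * x' + charQ (s, t) * y' := by
  have hk : HasDerivAt initSlope (deriv initSlope s) s :=
    ((contDiffAt_initSlope hs).differentiableAt (by simp)).hasDerivAt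
  generalize deriv initSlope s = k' at hk
  have hid := hasDerivAt_id s
  have hm : HasDerivAt angMom (initSlope s + s * k') s := by
    have h := hid.mul hk
    rwa [one_mul] at h
  -- the derivative of the quadratic equation for the initial slope
  have hrel : 2 * initSlope s * k' * (1 - s ^ 2) - 2 * s * initSlope s ^ 2 - 4 * initSlope s
      - 4 * s * k' + 4 * s = 0 := by
    have h0 : HasDerivAt (fun s => initSlope s ^ 2 * (1 - s ^ 2) - 4 * s * initSlope s +
        2 * s ^ 2 - 1) _ s := (((hk.pow 2).mul ((hid.pow 2).const_sub 1)).sub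
          ((hid.const_mul 4).mul hk)).add ((hid.pow 2).const_mul 2) |>.sub_const 1
    have h1 : (fun s => initSlope s ^ 2 * (1 - s ^ 2) - 4 * s * initSlope s +
        2 * s ^ 2 - 1) =ᶠ[𝓝 s] fun _ => 0 := by
      have : ∀ᶠ r in 𝓝 s, 1 - r ^ 2 ≠ 0 :=
        (by fun_prop : Continuous fun r : ℝ => 1 - r ^ 2).continuousAt.eventually_ne hs
      filter_upwards [this] with r hr using initSlope_eq hr
    have h2 := h0.unique ((hasDerivAt_const s (0 : ℝ)).congr_of_eventuallyEq h1)
    simp at h2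
    linear_combination h2
  have hθ : HasDerivAt (fun s => charAngle (s, t)) (2 * (initSlope s + s * k') * t) s := by
    simpa [charAngle] using ((hm.const_mul 2).const_add 4).mul_const t
  have hC := hθ.cos
  have hD := hθ.sin
  have hA := (hid.mul_const (Real.cos (2 * t))).sub (hid.mul_const (Real.sin (2 * t)))
  have hB := hk.mul_const (Real.sin (2 * t))
  have hx := (hC.mul hA).add (hD.mul hB)
  have hy := (hC.mul hB).sub (hD.mul hA)
  have hu := ((((hid.pow 2).neg.div_const 2).add (((hm.pow 2).const_sub 1).mul_const t)).add
    ((((hk.pow 2).mul_const (Real.sin (2 * t))).mul_const (Real.cos (2 * t))).div_const 2)).add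
    ((hid.pow 2).mul_const (Real.sin (2 * t) ^ 2))
  refine ⟨_, _, _, hx, hy, hu, ?_⟩
  have h1 := Real.sin_sq_add_cos_sq (charAngle (s, t))
  have h2 := Real.sin_sq_add_cos_sq (2 * t)
  simp only [charP, charQ, angMom, Pi.sub_apply, id]
  generalize Real.sin (charAngle (s, t)) = D at *
  generalize Real.cos (charAngle (s, t)) = C at *
  generalize Real.sin (2 * t) = S at *
  generalize Real.cos (2 * t) = c at *
  generalize initSlope s = k at *
  linear_combination -((-s * c - s * S) * (c - S) + k * c * (k' * S) - 2 * (k + s * k') * t *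
    ((s * c - s * S) * (k * c) + k * S * (s * c + s * S))) * h1 -
    (-s - 2 * (s * k) * (k + s * k') * t) * h2

lemma hasDerivAt_slice_fst {F : Type*} [NormedAddCommGroup F] [NormedSpace ℝ F] {f : ℝ × ℝ → F}
    {s t : ℝ} (hf : DifferentiableAt ℝ f (s, t)) :
    HasDerivAt (fun s => f (s, t)) (dx f (s, t)) s :=
  hf.hasFDerivAt.comp_hasDerivAt s ((hasDerivAt_id s).prodMk (hasDerivAt_const s t))

lemma hasDerivAt_slice_snd {F : Type*} [NormedAddCommGroup F] [NormedSpace ℝ F] {f : ℝ × ℝ → F}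
    {s t : ℝ} (hf : DifferentiableAt ℝ f (s, t)) :
    HasDerivAt (fun t => f (s, t)) (dy f (s, t)) t :=
  hf.hasFDerivAt.comp_hasDerivAt t ((hasDerivAt_const t s).prodMk (hasDerivAt_id t))

lemma fderiv_apply_eq_dx_dy {F : Type*} [NormedAddCommGroup F] [NormedSpace ℝ F] (f : ℝ × ℝ → F)
    (q w : ℝ × ℝ) : fderiv ℝ f q w = w.1 • dx f q + w.2 • dy f q := by
  have h : w = w.1 • ((1 : ℝ), (0 : ℝ)) + w.2 • ((0 : ℝ), (1 : ℝ)) := by ext <;> simp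
  conv_lhs => rw [h]
  rw [map_add, map_smul, map_smul, dx, dy]

/-- The projection of the characteristics to the plane of the variables. -/
noncomputable def charMap (σ : ℝ × ℝ) : ℝ × ℝ := (charX σ, charY σ)

lemma contDiffAt_initSlope_fst : ContDiffAt ℝ ω (fun σ : ℝ × ℝ => initSlope σ.1) 0 :=
  (contDiffAt_initSlope (s := 0) (by norm_num)).comp (0 : ℝ × ℝ) contDiffAt_fst

lemma contDiffAt_charAngle : ContDiffAt ℝ ω charAngle 0 := by
  have h := contDiffAt_initSlope_fst
  unfold charAngle angMom
  fun_prop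

lemma contDiffAt_charMap : ContDiffAt ℝ ω charMap 0 := by
  have h := contDiffAt_initSlope_fst
  have hC := contDiffAt_charAngle.cos
  have hD := contDiffAt_charAngle.sin
  unfold charMap charX charY
  fun_prop

lemma contDiffAt_charU : ContDiffAt ℝ ω charU 0 := by
  have h := contDiffAt_initSlope_fst
  unfold charU angMom
  fun_prop

lemma initSlope_zero : initSlope 0 = -1 := by simp [initSlope]

lemma charMap_axis (s : ℝ) : charMap (s, 0) = (s, 0) := by
  simp [charMap, charX, charY, charAngle]

/-- Near the origin, the differential of `charU` is `p dx + q dy`. -/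
lemma fderiv_charU : ∀ᶠ σ in 𝓝 (0 : ℝ × ℝ), ∀ w, fderiv ℝ charU σ w =
    charP σ * (fderiv ℝ charMap σ w).1 + charQ σ * (fderiv ℝ charMap σ w).2 := by
  have h0 : ∀ᶠ σ in 𝓝 (0 : ℝ × ℝ), 1 - σ.1 ^ 2 ≠ 0 :=
    (by fun_prop : Continuous fun σ : ℝ × ℝ => 1 - σ.1 ^ 2).continuousAt.eventually_ne (by simp)
  filter_upwards [h0, contDiffAt_charMap.eventually (by simp), contDiffAt_charU.eventually (by simp)]
    with σ hs hM hU w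
  obtain ⟨s, t⟩ := σ
  have hM' := hM.differentiableAt (by simp)
  have hU' := hU.differentiableAt (by simp)
  rw [fderiv_apply_eq_dx_dy charU, fderiv_apply_eq_dx_dy charMap]
  obtain ⟨x', y', u', hx, hy, hu, e⟩ := char_hasDerivAt_init (t := t) hs
  obtain ⟨x₂, y₂, u₂, hx₂, hy₂, hu₂, e₂, -⟩ := char_hasDerivAt_time (t := t) hs
  have e1 : dx charMap (s, t) = (x', y') := (hasDerivAt_slice_fst hM').unique (hx.prodMk hy)
  have e2 : dy charMap (s, t) = (x₂, y₂) := (hasDerivAt_slice_snd hM').unique (hx₂.prodMk hy₂)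
  rw [e1, e2, (hasDerivAt_slice_fst hU').unique hu, (hasDerivAt_slice_snd hU').unique hu₂, e, e₂]
  simp
  ring

/-- The differential at the origin of the projection of the characteristics, `diag (1, -2)`. -/
noncomputable def charEquiv : (ℝ × ℝ) ≃L[ℝ] ℝ × ℝ :=
  (ContinuousLinearEquiv.refl ℝ ℝ).prodCongr
    (ContinuousLinearEquiv.unitsEquivAut ℝ (Units.mk0 (-2) (by norm_num)))

lemma hasFDerivAt_charMap : HasFDerivAt charMap (charEquiv : (ℝ × ℝ) →L[ℝ] ℝ × ℝ) 0 := by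
  have hd := contDiffAt_charMap.differentiableAt (by simp)
  have key : fderiv ℝ charMap 0 = (charEquiv : (ℝ × ℝ) →L[ℝ] ℝ × ℝ) := by
    obtain ⟨x₂, y₂, u₂, hx₂, hy₂, -, -, ex, ey⟩ :=
      char_hasDerivAt_time (s := 0) (t := 0) (by norm_num)
    have e1 : dx charMap 0 = (1, 0) := by
      refine (hasDerivAt_slice_fst hd).unique ?_
      simp only [charMap_axis]
      exact (hasDerivAt_id _).prodMk (hasDerivAt_const _ _)
    have e2 : dy charMap 0 = (x₂, y₂) := (hasDerivAt_slice_snd hd).unique (hx₂.prodMk hy₂)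
    simp [charP, charQ, charX, charY, charAngle, initSlope_zero] at ex ey
    ext <;> simp [fderiv_apply_eq_dx_dy, e1, e2, ex, ey, charEquiv]
  rw [← key]
  exact hd.hasFDerivAt

/-- `φ` is analytic at the origin and satisfies, near the origin, the equation (squared) and the
initial conditions. -/
structure IsSolutionGerm (φ : ℝ × ℝ → ℝ) : Prop where
  contDiffAt : ContDiffAt ℝ ω φ 0
  equation : ∀ᶠ z in 𝓝 (0 : ℝ × ℝ), dx φ z ^ 2 + dy φ z ^ 2 + z.1 ^ 2 + z.2 ^ 2 =
      1 + 4 * (z.1 * dy φ z - z.2 * dx φ z) + (z.1 * dy φ z - z.2 * dx φ z) ^ 2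
  initial : ∀ᶠ x in 𝓝 (0 : ℝ), φ (x, 0) = -x ^ 2 / 2
  dy_zero : dy φ 0 = -1

/-- The solution is the primitive `charU` of `p dx + q dy` on the surface swept out by the
characteristics, which near the origin projects diffeomorphically to the plane of the variables. -/
theorem exists_isSolutionGerm : ∃ φ : ℝ × ℝ → ℝ, IsSolutionGerm φ := by
  have hM := contDiffAt_charMap
  have hM' := hasFDerivAt_charMap
  have hM0 : charMap 0 = 0 := charMap_axis 0
  have hst : HasStrictFDerivAt charMap (charEquiv : (ℝ × ℝ) →L[ℝ] ℝ × ℝ) 0 :=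
    hM.hasStrictFDerivAt' hM' (by simp)
  set N := hst.localInverse charMap charEquiv 0 with hN
  have hNc : ContDiffAt ℝ ω N 0 := by
    have h := hM.to_localInverse hM' (by simp)
    rw [hM0] at h
    exact h
  have hleft : ∀ᶠ σ in 𝓝 (0 : ℝ × ℝ), N (charMap σ) = σ := hst.eventually_left_inverse
  have hright : ∀ᶠ z in 𝓝 (0 : ℝ × ℝ), charMap (N z) = z := by
    have h := hst.eventually_right_inverse
    rwa [hM0] at h
  have hN0 : N 0 = 0 := by
    have h := hleft.self_of_nhds
    rwa [hM0] at h
  have hφ : ContDiffAt ℝ ω (charU ∘ N) 0 := by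
    refine ContDiffAt.comp _ ?_ hNc
    rw [hN0]
    exact contDiffAt_charU
  -- along the characteristics, the differential of the solution is `p dx + q dy`
  have hgrad : ∀ᶠ σ in 𝓝 (0 : ℝ × ℝ), dx (charU ∘ N) (charMap σ) = charP σ ∧
      dy (charU ∘ N) (charMap σ) = charQ σ := by
    have hinv : ∀ᶠ σ in 𝓝 (0 : ℝ × ℝ), ∃ e : (ℝ × ℝ) ≃L[ℝ] ℝ × ℝ,
        (e : (ℝ × ℝ) →L[ℝ] ℝ × ℝ) = fderiv ℝ charMap σ := by
      have hc : ContinuousAt (fderiv ℝ charMap) 0 :=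
        (hM.fderiv_right (m := 0) (by simp)).continuousAt
      have h := charEquiv.nhds
      rw [← hM'.fderiv] at h
      exact hc h
    have hφM : ∀ᶠ σ in 𝓝 (0 : ℝ × ℝ), ContDiffAt ℝ ω (charU ∘ N) (charMap σ) := by
      have h := hφ.eventually (by simp)
      rw [← hM0] at h
      exact hM.continuousAt.eventually h
    filter_upwards [hinv, hφM, hM.eventually (by simp), hleft.eventually_nhds, fderiv_charU]
      with σ ⟨e, he⟩ h1 h2 h3 h4
    have hcomp : fderiv ℝ charU σ =
        (fderiv ℝ (charU ∘ N) (charMap σ)).comp (fderiv ℝ charMap σ) := by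
      rw [← fderiv_comp σ (h1.differentiableAt (by simp)) (h2.differentiableAt (by simp))]
      refine Filter.EventuallyEq.fderiv_eq ?_
      filter_upwards [h3] with τ hτ
      simp [hτ]
    have h5 : ∀ v, fderiv ℝ (charU ∘ N) (charMap σ) v = charP σ * v.1 + charQ σ * v.2 := by
      intro v
      have h6 := h4 (e.symm v)
      rw [hcomp, ← he] at h6
      simpa using h6
    simp [dx, dy, h5]
  have hgrad' : ∀ᶠ z in 𝓝 (0 : ℝ × ℝ), dx (charU ∘ N) z = charP (N z) ∧
      dy (charU ∘ N) z = charQ (N z) := by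
    have hc := hNc.continuousAt
    rw [ContinuousAt, hN0] at hc
    filter_upwards [hc.eventually hgrad, hright] with z h1 h2
    rwa [h2] at h1
  refine ⟨charU ∘ N, hφ, ?_, ?_, ?_⟩
  · have hs : ∀ᶠ z in 𝓝 (0 : ℝ × ℝ), 1 - (N z).1 ^ 2 ≠ 0 := by
      refine ContinuousAt.eventually_ne (g := fun z => 1 - (N z).1 ^ 2) ?_ (by simp [hN0])
      have hc := hNc.continuousAt
      fun_prop
    filter_upwards [hgrad', hright, hs] with z ⟨h1, h2⟩ h3 h4
    rw [h1, h2]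
    have hx : z.1 = charX (N z) := congrArg Prod.fst h3.symm
    have hy : z.2 = charY (N z) := congrArg Prod.snd h3.symm
    rw [hx, hy, charX_mul_charQ_sub, char_sq_equation h4]
  · have hc : ContinuousAt (fun x : ℝ => (x, (0 : ℝ))) 0 := by fun_prop
    filter_upwards [hc.eventually hleft] with x hx
    rw [charMap_axis] at hx
    simp [hx, charU]
  · rw [hgrad'.self_of_nhds.2, hN0]
    simp [charQ, charAngle, initSlope_zero]

/-! ### Bivectors and Klein coordinates -/

lemma inner_R3 (v w : R3) : inner ℝ v w = v 0 * w 0 + v 1 * w 1 + v 2 * w 2 := by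
  simp [PiLp.inner_apply, Fin.sum_univ_succ]; ring

lemma inner_R4 (v w : R4) :
    inner ℝ v w = v 0 * w 0 + v 1 * w 1 + v 2 * w 2 + v 3 * w 3 := by
  simp [PiLp.inner_apply, Fin.sum_univ_succ]; ring

lemma norm_sq_R3 (v : R3) : ‖v‖ ^ 2 = v 0 ^ 2 + v 1 ^ 2 + v 2 ^ 2 := by
  rw [← real_inner_self_eq_norm_sq, inner_R3]; ring

lemma norm_sq_R6 (P : R6) : ‖P‖ ^ 2 =
    P 0 ^ 2 + P 1 ^ 2 + P 2 ^ 2 + P 3 ^ 2 + P 4 ^ 2 + P 5 ^ 2 := by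
  simp [EuclideanSpace.norm_sq_eq, Fin.sum_univ_succ]; ring

/-- The exterior product of two vectors as a bilinear map. -/
noncomputable def wedgeBilin : R4 →L[ℝ] R4 →L[ℝ] R6 :=
  LinearMap.toContinuousBilinearMap <| LinearMap.mk₂ ℝ wedge
    (fun v v' w => by ext i; fin_cases i <;> simp [wedge] <;> ring)
    (fun c v w => by ext i; fin_cases i <;> simp [wedge] <;> ring)
    (fun v w w' => by ext i; fin_cases i <;> simp [wedge] <;> ring)
    (fun c v w => by ext i; fin_cases i <;> simp [wedge] <;> ring)

lemma wedgeBilin_apply (v w : R4) : wedgeBilin v w = wedge v w := rfl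

/-- The coordinates `a` as a linear map. -/
noncomputable def kleinAL : R6 →L[ℝ] R3 := LinearMap.toContinuousLinearMap
  { toFun := kleinA
    map_add' := fun P Q => by ext i; fin_cases i <;> simp [kleinA] <;> ring
    map_smul' := fun c P => by ext i; fin_cases i <;> simp [kleinA] <;> ring }

/-- The coordinates `b` as a linear map. -/
noncomputable def kleinBL : R6 →L[ℝ] R3 := LinearMap.toContinuousLinearMap
  { toFun := kleinB
    map_add' := fun P Q => by ext i; fin_cases i <;> simp [kleinB] <;> ring
    map_smul' := fun c P => by ext i; fin_cases i <;> simp [kleinB] <;> ring }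

/-- The bivector whose Klein coordinates are `a` and `0`. -/
noncomputable def ofKleinA : R3 →L[ℝ] R6 := LinearMap.toContinuousLinearMap
  { toFun := fun a => !₂[a 0 / 2, a 1 / 2, a 2 / 2, a 0 / 2, a 1 / 2, a 2 / 2]
    map_add' := fun a b => by ext i; fin_cases i <;> simp <;> ring
    map_smul' := fun c a => by ext i; fin_cases i <;> simp <;> ring }

/-- The bivector whose Klein coordinates are `0` and `b`. -/
noncomputable def ofKleinB : R3 →L[ℝ] R6 := LinearMap.toContinuousLinearMap
  { toFun := fun b => !₂[b 0 / 2, b 1 / 2, b 2 / 2, -b 0 / 2, -b 1 / 2, -b 2 / 2]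
    map_add' := fun a b => by ext i; fin_cases i <;> simp <;> ring
    map_smul' := fun c a => by ext i; fin_cases i <;> simp <;> ring }

lemma ofKleinA_apply (a : R3) :
    ofKleinA a = !₂[a 0 / 2, a 1 / 2, a 2 / 2, a 0 / 2, a 1 / 2, a 2 / 2] := rfl

lemma ofKleinB_apply (b : R3) :
    ofKleinB b = !₂[b 0 / 2, b 1 / 2, b 2 / 2, -b 0 / 2, -b 1 / 2, -b 2 / 2] := rfl

lemma kleinAL_apply (P : R6) : kleinAL P = kleinA P := rfl

lemma kleinBL_apply (P : R6) : kleinBL P = kleinB P := rfl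

lemma ofKlein_klein (P : R6) : ofKleinA (kleinA P) + ofKleinB (kleinB P) = P := by
  ext i; fin_cases i <;> simp [ofKleinA_apply, ofKleinB_apply, kleinA, kleinB] <;> ring

lemma kleinA_ofKlein (a b : R3) : kleinA (ofKleinA a + ofKleinB b) = a := by
  ext i; fin_cases i <;> simp [ofKleinA_apply, ofKleinB_apply, kleinA] <;> ring

lemma kleinB_ofKlein (a b : R3) : kleinB (ofKleinA a + ofKleinB b) = b := by
  ext i; fin_cases i <;> simp [ofKleinA_apply, ofKleinB_apply, kleinB] <;> ring

/-- In Klein coordinates the Grassmannian is the product of two unit spheres. -/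
lemma mem_grassmannian_iff (P : R6) : P ∈ grassmannian ↔ ‖kleinA P‖ = 1 ∧ ‖kleinB P‖ = 1 := by
  have hA : ‖kleinA P‖ ^ 2 = ‖P‖ ^ 2 + 2 * (P 0 * P 3 + P 1 * P 4 + P 2 * P 5) := by
    rw [norm_sq_R3, norm_sq_R6]; simp [kleinA]; ring
  have hB : ‖kleinB P‖ ^ 2 = ‖P‖ ^ 2 - 2 * (P 0 * P 3 + P 1 * P 4 + P 2 * P 5) := by
    rw [norm_sq_R3, norm_sq_R6]; simp [kleinB]; ring
  rw [← sq_eq_sq₀ (norm_nonneg (kleinA P)) zero_le_one,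
    ← sq_eq_sq₀ (norm_nonneg (kleinB P)) zero_le_one, hA, hB]
  unfold grassmannian
  rw [Set.mem_ofPred_eq, ← sq_eq_sq₀ (norm_nonneg P) zero_le_one]
  constructor
  · rintro ⟨h1, h2⟩
    constructor <;> linarith
  · rintro ⟨h1, h2⟩
    constructor <;> linarith

lemma wedge_plucker (v w : R4) : (wedge v w) 0 * (wedge v w) 3 + (wedge v w) 1 * (wedge v w) 4 +
    (wedge v w) 2 * (wedge v w) 5 = 0 := by
  simp [wedge]; ring

/-- Lagrange's identity. -/
lemma norm_wedge_sq (v w : R4) :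
    ‖wedge v w‖ ^ 2 = ‖v‖ ^ 2 * ‖w‖ ^ 2 - inner ℝ v w ^ 2 := by
  rw [norm_sq_R6, ← real_inner_self_eq_norm_sq, ← real_inner_self_eq_norm_sq]
  simp only [inner_R4]
  simp [wedge]; ring

lemma inner_kleinB_wedge_left (v w w' : R4) :
    inner ℝ (kleinB (wedge v w)) (kleinB (wedge v w')) =
      inner ℝ v v * inner ℝ w w' - inner ℝ v w' * inner ℝ w v := by
  simp only [inner_R3, inner_R4]
  simp [wedge, kleinB]; ring

lemma wedge_swap (v w : R4) : wedge w v = -wedge v w := by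
  ext i; fin_cases i <;> simp [wedge] <;> ring

lemma kleinB_neg (P : R6) : kleinB (-P) = -kleinB P := kleinBL.map_neg P

lemma inner_kleinB_wedge_right (v v' w : R4) :
    inner ℝ (kleinB (wedge v w)) (kleinB (wedge v' w)) =
      inner ℝ w w * inner ℝ v v' - inner ℝ w v' * inner ℝ v w := by
  rw [wedge_swap w v, wedge_swap w v', kleinB_neg, kleinB_neg, inner_neg_neg,
    inner_kleinB_wedge_left]

/-- The inner product of two anti-self-dual parts: the determinant is the exterior product of
the two bivectors. -/
lemma inner_kleinB_wedge (e : Fin 4 → R4) :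
    inner ℝ (kleinB (wedge (e 0) (e 1))) (kleinB (wedge (e 2) (e 3))) =
      inner ℝ (e 0) (e 2) * inner ℝ (e 1) (e 3) - inner ℝ (e 0) (e 3) * inner ℝ (e 1) (e 2) -
        (Matrix.of fun i j : Fin 4 => e j i).det := by
  simp only [inner_R3, inner_R4]
  simp [wedge, kleinB, Matrix.det_succ_row_zero, Fin.sum_univ_succ, Fin.succAbove]
  ring

/-- The Hodge star maps `e₀ ∧ e₁` to `e₂ ∧ e₃`, hence the anti-self-dual parts of these two
bivectors are opposite. -/
lemma kleinB_wedge_eq_neg {e : Fin 4 → R4} (he : Orthonormal ℝ e)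
    (hpos : 0 < (Matrix.of fun i j : Fin 4 => e j i).det) :
    kleinB (wedge (e 0) (e 1)) = -kleinB (wedge (e 2) (e 3)) := by
  have hi : ∀ i j, inner ℝ (e i) (e j) = if i = j then (1 : ℝ) else 0 :=
    orthonormal_iff_ite.mp he
  have hdet : (Matrix.of fun i j : Fin 4 => e j i).det = 1 := by
    have hM : (Matrix.of fun i j : Fin 4 => e j i).transpose *
        (Matrix.of fun i j : Fin 4 => e j i) = 1 := by
      ext i j
      have h := hi i j
      rw [inner_R4] at h
      simp [Matrix.mul_apply, Fin.sum_univ_four, Matrix.one_apply, h]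
    have h := congrArg Matrix.det hM
    rw [Matrix.det_mul, Matrix.det_transpose, Matrix.det_one] at h
    nlinarith
  have h : ‖kleinB (wedge (e 0) (e 1)) + kleinB (wedge (e 2) (e 3))‖ ^ 2 = 0 := by
    rw [norm_add_sq_real, inner_kleinB_wedge, hdet, ← real_inner_self_eq_norm_sq,
      ← real_inner_self_eq_norm_sq, inner_kleinB_wedge_left, inner_kleinB_wedge_left]
    simp only [hi]
    norm_num [Fin.ext_iff]
  exact eq_neg_of_add_eq_zero_left (by simpa using h)

/-- The anti-self-dual parts of complementary coordinate planes are opposite also for the frames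
obtained by cyclic permutations of the last three vectors, which preserve the orientation. -/
lemma kleinB_wedge_perm {e : Fin 4 → R4} (he : Orthonormal ℝ e)
    (hpos : 0 < (Matrix.of fun i j : Fin 4 => e j i).det) :
    kleinB (wedge (e 0) (e 2)) = -kleinB (wedge (e 3) (e 1)) ∧
      kleinB (wedge (e 0) (e 3)) = -kleinB (wedge (e 1) (e 2)) := by
  have key : ∀ τ : Equiv.Perm (Fin 4), Equiv.Perm.sign τ = 1 →
      kleinB (wedge (e (τ 0)) (e (τ 1))) = -kleinB (wedge (e (τ 2)) (e (τ 3))) := by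
    intro τ hτ
    refine kleinB_wedge_eq_neg (e := e ∘ τ) (he.comp τ τ.injective) ?_
    have h := Matrix.det_permute' τ (Matrix.of fun i j : Fin 4 => e j i)
    rw [hτ] at h
    rw [Units.val_one, Int.cast_one, one_mul] at h
    rw [← h] at hpos
    exact hpos
  have h1 := key (Equiv.swap 1 2 * Equiv.swap 2 3) (by decide)
  have h2 := key (Equiv.swap 1 3 * Equiv.swap 2 3) (by decide)
  generalize hτ : Equiv.swap (1 : Fin 4) 2 * Equiv.swap 2 3 = τ at h1
  generalize hρ : Equiv.swap (1 : Fin 4) 3 * Equiv.swap 2 3 = ρ at h2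
  rw [show τ 0 = 0 by rw [← hτ]; decide, show τ 1 = 2 by rw [← hτ]; decide,
    show τ 2 = 3 by rw [← hτ]; decide, show τ 3 = 1 by rw [← hτ]; decide] at h1
  rw [show ρ 0 = 0 by rw [← hρ]; decide, show ρ 1 = 3 by rw [← hρ]; decide,
    show ρ 2 = 1 by rw [← hρ]; decide, show ρ 3 = 2 by rw [← hρ]; decide] at h2
  exact ⟨h1, h2⟩

section

/-! ### The Gauss map of an immersed surface -/

variable {Ξ : ℝ × ℝ → R4} {U : Set (ℝ × ℝ)} {q : ℝ × ℝ}

namespace IsImmersedOn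

lemma contDiffAt (h : IsImmersedOn Ξ U) (hq : q ∈ U) : ContDiffAt ℝ ∞ Ξ q :=
  h.smooth.contDiffAt (h.isOpen.mem_nhds hq)

lemma contDiffAt_fderiv (h : IsImmersedOn Ξ U) (hq : q ∈ U) :
    ContDiffAt ℝ ∞ (fderiv ℝ Ξ) q :=
  (h.contDiffAt hq).fderiv_right (by simp)

lemma differentiableAt_fderiv (h : IsImmersedOn Ξ U) (hq : q ∈ U) :
    DifferentiableAt ℝ (fderiv ℝ Ξ) q :=
  (h.contDiffAt_fderiv hq).differentiableAt (by simp)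

lemma wedge_ne_zero (h : IsImmersedOn Ξ U) (hq : q ∈ U) : wedge (dx Ξ q) (dy Ξ q) ≠ 0 := by
  intro h0
  have hL := norm_wedge_sq (dx Ξ q) (dy Ξ q)
  rw [h0] at hL
  have h1 : ‖(-inner ℝ (dx Ξ q) (dy Ξ q)) • dx Ξ q + (‖dx Ξ q‖ ^ 2) • dy Ξ q‖ ^ 2 = 0 := by
    rw [norm_add_sq_real, norm_smul, norm_smul, real_inner_smul_left, real_inner_smul_right]
    simp only [mul_pow, Real.norm_eq_abs, sq_abs]
    simp only [norm_zero] at hL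
    linear_combination -‖dx Ξ q‖ ^ 2 * hL
  have h2 : fderiv ℝ Ξ q (-inner ℝ (dx Ξ q) (dy Ξ q), ‖dx Ξ q‖ ^ 2) = 0 := by
    rw [fderiv_apply_eq_dx_dy]
    simpa using h1
  have h3 := h.immersion q hq (h2.trans (map_zero _).symm)
  have h4 : dx Ξ q = 0 := by simpa using congrArg Prod.snd h3
  have h5 := h.immersion q hq (h4.trans (map_zero _).symm)
  simpa using congrArg Prod.fst h5

lemma contDiffAt_wedge (h : IsImmersedOn Ξ U) (hq : q ∈ U) :
    ContDiffAt ℝ ∞ (fun p => wedge (dx Ξ p) (dy Ξ p)) q := by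
  have hD := h.contDiffAt_fderiv hq
  have hx : ContDiffAt ℝ ∞ (dx Ξ) q := hD.clm_apply contDiffAt_const
  have hy : ContDiffAt ℝ ∞ (dy Ξ) q := hD.clm_apply contDiffAt_const
  exact (wedgeBilin.contDiff.contDiffAt.comp q hx).clm_apply hy

lemma contDiffAt_norm_wedge (h : IsImmersedOn Ξ U) (hq : q ∈ U) :
    ContDiffAt ℝ ∞ (fun p => ‖wedge (dx Ξ p) (dy Ξ p)‖) q :=
  (h.contDiffAt_wedge hq).norm ℝ (h.wedge_ne_zero hq)

lemma contDiffAt_gaussMap (h : IsImmersedOn Ξ U) (hq : q ∈ U) :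
    ContDiffAt ℝ ∞ (gaussMap Ξ) q :=
  ((h.contDiffAt_norm_wedge hq).inv (norm_ne_zero_iff.mpr (h.wedge_ne_zero hq))).smul
    (h.contDiffAt_wedge hq)

lemma contDiffAt_gauss₁ (h : IsImmersedOn Ξ U) (hq : q ∈ U) : ContDiffAt ℝ ∞ (gauss₁ Ξ) q :=
  kleinAL.contDiff.contDiffAt.comp q (h.contDiffAt_gaussMap hq)

lemma contDiffAt_gauss₂ (h : IsImmersedOn Ξ U) (hq : q ∈ U) : ContDiffAt ℝ ∞ (gauss₂ Ξ) q :=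
  kleinBL.contDiff.contDiffAt.comp q (h.contDiffAt_gaussMap hq)

lemma norm_smul_gaussMap (h : IsImmersedOn Ξ U) (hq : q ∈ U) :
    ‖wedge (dx Ξ q) (dy Ξ q)‖ • gaussMap Ξ q = wedge (dx Ξ q) (dy Ξ q) :=
  smul_inv_smul₀ (norm_ne_zero_iff.mpr (h.wedge_ne_zero hq)) _

lemma gaussMap_mem_grassmannian (h : IsImmersedOn Ξ U) (hq : q ∈ U) :
    gaussMap Ξ q ∈ grassmannian := by
  refine ⟨norm_smul_inv_norm (𝕜 := ℝ) (h.wedge_ne_zero hq), ?_⟩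
  have h1 := wedge_plucker (dx Ξ q) (dy Ξ q)
  simp only [gaussMap, PiLp.smul_apply, smul_eq_mul]
  linear_combination (‖wedge (dx Ξ q) (dy Ξ q)‖⁻¹) ^ 2 * h1

end IsImmersedOn

/-- A surface whose second spherical image lies on a circle has, at each point, a direction along
which the second component of the Gauss map is stationary: its values lie on a curve. -/
lemma exists_fderiv_gauss₂_eq_zero (h : IsImmersedOn Ξ U) {c : ℝ} (hc : c ^ 2 < 1)
    (hb : gauss₂ Ξ '' U ⊆ sphereCircle c) (hq : q ∈ U) :
    ∃ w ≠ 0, fderiv ℝ (gauss₂ Ξ) q w = 0 := by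
  have hd := ((h.contDiffAt_gauss₂ hq).differentiableAt (by simp)).hasFDerivAt
  have hmem : ∀ᶠ p in 𝓝 q, gauss₂ Ξ p ∈ sphereCircle c := by
    filter_upwards [h.isOpen.mem_nhds hq] with p hp using hb ⟨p, hp, rfl⟩
  have hcoord : ∀ i, HasFDerivAt (fun p => gauss₂ Ξ p i)
      ((EuclideanSpace.proj i : R3 →L[ℝ] ℝ).comp (fderiv ℝ (gauss₂ Ξ) q)) q :=
    fun i => (EuclideanSpace.proj i : R3 →L[ℝ] ℝ).hasFDerivAt.comp q hd
  have h0 : ∀ w, (fderiv ℝ (gauss₂ Ξ) q w) 0 = 0 := by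
    intro w
    have e : (fun p => gauss₂ Ξ p 0) =ᶠ[𝓝 q] fun _ => c := by
      filter_upwards [hmem] with p hp using hp.2
    have := (hcoord 0).unique ((hasFDerivAt_const c q).congr_of_eventuallyEq e)
    simpa using congrArg (fun L : (ℝ × ℝ) →L[ℝ] ℝ => L w) this
  have h12 : ∀ w, gauss₂ Ξ q 1 * (fderiv ℝ (gauss₂ Ξ) q w) 1 +
      gauss₂ Ξ q 2 * (fderiv ℝ (gauss₂ Ξ) q w) 2 = 0 := by
    intro w
    have e : (fun p => gauss₂ Ξ p 1 * gauss₂ Ξ p 1 + gauss₂ Ξ p 2 * gauss₂ Ξ p 2) =ᶠ[𝓝 q]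
        fun _ => 1 - c ^ 2 := by
      filter_upwards [hmem] with p hp
      have h1 := norm_sq_R3 (gauss₂ Ξ p)
      rw [hp.1, hp.2] at h1
      linear_combination -h1
    have := (((hcoord 1).mul (hcoord 1)).add ((hcoord 2).mul (hcoord 2))).unique
      ((hasFDerivAt_const (1 - c ^ 2) q).congr_of_eventuallyEq e)
    have := congrArg (fun L : (ℝ × ℝ) →L[ℝ] ℝ => L w) this
    simp at this
    linear_combination this / 2
  have hne : gauss₂ Ξ q 1 ^ 2 + gauss₂ Ξ q 2 ^ 2 ≠ 0 := by
    obtain ⟨hn, hn0⟩ := hmem.self_of_nhds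
    have h1 := norm_sq_R3 (gauss₂ Ξ q)
    rw [hn, hn0] at h1
    nlinarith
  -- the derivative is determined by its component along the tangent of the circle
  set ℓ : (ℝ × ℝ) →L[ℝ] ℝ := gauss₂ Ξ q 1 • (EuclideanSpace.proj 2 : R3 →L[ℝ] ℝ).comp
      (fderiv ℝ (gauss₂ Ξ) q) - gauss₂ Ξ q 2 • (EuclideanSpace.proj 1 : R3 →L[ℝ] ℝ).comp
      (fderiv ℝ (gauss₂ Ξ) q) with hℓ
  have hker : ∃ w ≠ 0, ℓ w = 0 := by
    by_contra! hcon
    have hinj : Function.Injective ℓ.toLinearMap :=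
      (injective_iff_map_eq_zero _).mpr fun w hw => by_contra fun hw0 => hcon w hw0 hw
    have := LinearMap.finrank_le_finrank_of_injective hinj
    simp at this
  obtain ⟨w, hw, hw0⟩ := hker
  refine ⟨w, hw, ?_⟩
  have h3 := h12 w
  have h4 : gauss₂ Ξ q 1 * (fderiv ℝ (gauss₂ Ξ) q w) 2 -
      gauss₂ Ξ q 2 * (fderiv ℝ (gauss₂ Ξ) q w) 1 = 0 := by simpa [hℓ] using hw0
  have h5 : (fderiv ℝ (gauss₂ Ξ) q w) 1 = 0 := by
    refine (mul_eq_zero.mp ?_).resolve_left hne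
    linear_combination gauss₂ Ξ q 1 * h3 - gauss₂ Ξ q 2 * h4
  have h6 : (fderiv ℝ (gauss₂ Ξ) q w) 2 = 0 := by
    refine (mul_eq_zero.mp ?_).resolve_left hne
    linear_combination gauss₂ Ξ q 2 * h3 + gauss₂ Ξ q 1 * h4
  ext i
  fin_cases i
  · exact h0 w
  · exact h5
  · exact h6

/-- A direction in which the second component of the Gauss map is stationary is isoclinic: the
tangent plane moves along the sheet with fixed `b`, as one sees by freezing `b`. -/
lemma isIsoclinicDirection_of_fderiv_gauss₂_eq_zero (h : IsImmersedOn Ξ U) (hq : q ∈ U)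
    {w : ℝ × ℝ} (hw : w ≠ 0) (hb : fderiv ℝ (gauss₂ Ξ) q w = 0) :
    ∃ u, IsIsoclinicDirection isoclineMinus Ξ q u := by
  have hne : ‖fderiv ℝ Ξ q w‖ ≠ 0 := by
    rw [norm_ne_zero_iff]
    intro h0
    exact hw (h.immersion q hq (h0.trans (map_zero _).symm))
  set r := ‖fderiv ℝ Ξ q w‖⁻¹ with hr
  set γ : ℝ → ℝ × ℝ := fun t => q + t • (r • w) with hγ
  have hγ0 : γ 0 = q := by simp [hγ]
  have hγ' : HasDerivAt γ (r • w) 0 := by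
    have h := ((hasDerivAt_id (0 : ℝ)).smul_const (r • w)).const_add q
    rwa [one_smul] at h
  have hcomp : ∀ {F : Type} [NormedAddCommGroup F] [NormedSpace ℝ F] {f : ℝ × ℝ → F},
      DifferentiableAt ℝ f q → HasDerivAt (f ∘ γ) (fderiv ℝ f q (r • w)) 0 := by
    intro F _ _ f hf
    refine HasFDerivAt.comp_hasDerivAt 0 ?_ hγ'
    rw [hγ0]
    exact hf.hasFDerivAt
  have hG := (h.contDiffAt_gaussMap hq).differentiableAt (by simp)
  have hA : fderiv ℝ (gauss₁ Ξ) q = kleinAL.comp (fderiv ℝ (gaussMap Ξ) q) :=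
    (kleinAL.hasFDerivAt.comp q hG.hasFDerivAt).fderiv
  have hB : fderiv ℝ (gauss₂ Ξ) q = kleinBL.comp (fderiv ℝ (gaussMap Ξ) q) :=
    (kleinBL.hasFDerivAt.comp q hG.hasFDerivAt).fderiv
  refine ⟨fderiv ℝ Ξ q (r • w), ?_, γ, by fun_prop, hγ0,
    hcomp ((h.contDiffAt hq).differentiableAt (by simp)), _, ?_, hcomp hG⟩
  · rw [map_smul, norm_smul, hr, norm_inv, norm_norm, inv_mul_cancel₀ hne]
  refine ⟨fun t => ofKleinA (gauss₁ Ξ (γ t)) + ofKleinB (gauss₂ Ξ q), ?_, ?_, ?_⟩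
  · have hev : ∀ᶠ t in 𝓝 (0 : ℝ), γ t ∈ U := by
      refine hγ'.continuousAt.eventually ?_
      rw [hγ0]
      exact h.isOpen.mem_nhds hq
    filter_upwards [hev] with t ht
    refine ⟨?_, kleinB_ofKlein _ _⟩
    rw [mem_grassmannian_iff, kleinA_ofKlein, kleinB_ofKlein]
    exact ⟨((mem_grassmannian_iff _).mp (h.gaussMap_mem_grassmannian ht)).1,
      ((mem_grassmannian_iff _).mp (h.gaussMap_mem_grassmannian hq)).2⟩
  · simp only [hγ0]
    exact ofKlein_klein _
  · have h1 := hcomp ((h.contDiffAt_gauss₁ hq).differentiableAt (by simp))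
    have h2 := (ofKleinA.hasFDerivAt.comp_hasDerivAt 0 h1).add_const (ofKleinB (gauss₂ Ξ q))
    have h3 : kleinB (fderiv ℝ (gaussMap Ξ) q (r • w)) = 0 := by
      have h4 : fderiv ℝ (gauss₂ Ξ) q (r • w) = 0 := by rw [map_smul, hb, smul_zero]
      rw [hB] at h4
      exact h4
    have h5 : ofKleinA (fderiv ℝ (gauss₁ Ξ) q (r • w)) = fderiv ℝ (gaussMap Ξ) q (r • w) := by
      have h6 := ofKlein_klein (fderiv ℝ (gaussMap Ξ) q (r • w))
      rw [h3, map_zero, add_zero] at h6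
      rw [hA]
      exact h6
    rw [← h5]
    exact h2

/-! ### Adapted frames and the two curvatures -/

lemma IsImmersedOn.exists_isAdaptedFrame (h : IsImmersedOn Ξ U) (hq : q ∈ U) :
    ∃ e w, IsAdaptedFrame Ξ q e w := by
  set T := LinearMap.range (fderiv ℝ Ξ q).toLinearMap with hT
  have hfin : Module.finrank ℝ T = 2 := by
    rw [hT, LinearMap.finrank_range_of_inj (h.immersion q hq)]
    simp
  set b := (stdOrthonormalBasis ℝ T).reindex (finCongr hfin) with hb
  have hpre : ∀ i, ∃ w, fderiv ℝ Ξ q w = b i := fun i => (b i).2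
  choose w hw using hpre
  have hbo : Orthonormal ℝ fun i => (b i : R4) := b.orthonormal.comp_linearIsometry T.subtypeₗᵢ
  -- an orthonormal basis of the whole space that extends the one of the tangent plane
  have hext : Orthonormal ℝ (({0, 1} : Set (Fin 4)).domRestrict
      (![(b 0 : R4), (b 1 : R4), 0, 0] : Fin 4 → R4)) := by
    have hi := orthonormal_iff_ite.mp hbo
    rw [orthonormal_iff_ite]
    rintro ⟨i, rfl | rfl⟩ ⟨j, rfl | rfl⟩
    · simpa using hi 0 0
    · simpa [Subtype.ext_iff] using hi 0 1
    · simpa [Subtype.ext_iff] using hi 1 0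
    · simpa using hi 1 1
  obtain ⟨f, hf⟩ := Orthonormal.exists_orthonormalBasis_extension_of_card_eq
    (by simp : Module.finrank ℝ R4 = Fintype.card (Fin 4)) hext
  have hf0 : f 0 = b 0 := by simpa using hf 0 (by simp)
  have hf1 : f 1 = b 1 := by simpa using hf 1 (by simp)
  have hdet : (Matrix.of fun i j : Fin 4 => f j i).det ≠ 0 := by
    have hM : (Matrix.of fun i j : Fin 4 => f j i).transpose *
        (Matrix.of fun i j : Fin 4 => f j i) = 1 := by
      ext i j
      have h := orthonormal_iff_ite.mp f.orthonormal i j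
      rw [inner_R4] at h
      simp [Matrix.mul_apply, Fin.sum_univ_four, Matrix.one_apply, h]
    intro h0
    have h := congrArg Matrix.det hM
    rw [Matrix.det_mul, h0] at h
    simp at h
  rcases lt_or_gt_of_ne hdet with hneg | hpos
  · -- the other orientation is corrected by reversing the last vector
    refine ⟨Function.update f 3 (-f 3), w, ?_, ?_, ?_, ?_⟩
    · have hi := orthonormal_iff_ite.mp f.orthonormal
      rw [orthonormal_iff_ite]
      intro i j
      have hij := hi i j
      by_cases h3 : i = 3 <;> by_cases h3' : j = 3
      · subst h3 h3'; simp
      · subst h3; simp [Function.update_of_ne h3', hij, Ne.symm h3']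
      · subst h3'; simp [hij, h3]
      · simp [Function.update_of_ne h3, Function.update_of_ne h3', hij]
    · have hup : (Matrix.of fun i j : Fin 4 => (Function.update f 3 (-f 3) : Fin 4 → R4) j i) =
          (Matrix.of fun i j : Fin 4 => f j i).updateCol 3
            ((-1 : ℝ) • fun i => f 3 i) := by
        ext i j
        by_cases h3 : j = 3
        · subst h3; simp
        · simp [Function.update_of_ne h3, Matrix.updateCol_ne h3]
      have hself : (Matrix.of fun i j : Fin 4 => f j i).updateCol 3 (fun i => f 3 i) =
          Matrix.of fun i j : Fin 4 => f j i := by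
        ext i j
        by_cases h3 : j = 3
        · subst h3; simp
        · simp [Matrix.updateCol_ne h3]
      rw [hup, Matrix.det_updateCol_smul, hself]
      linarith
    · rw [hw]; simp [hf0]
    · rw [hw]; simp [hf1]
  · exact ⟨f, w, f.orthonormal, hpos, by rw [hw, hf0], by rw [hw, hf1]⟩

lemma wedge_lin (a b c d : ℝ) (v w : R4) :
    wedge (a • v + b • w) (c • v + d • w) = (a * d - b * c) • wedge v w := by
  ext i; fin_cases i <;> simp [wedge] <;> ring

lemma IsAdaptedFrame.exists_eq_smul_add_smul {e : Fin 4 → R4} {w : Fin 2 → ℝ × ℝ}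
    (he : IsAdaptedFrame Ξ q e w) (W : ℝ × ℝ) : ∃ l m : ℝ, W = l • w 0 + m • w 1 := by
  have hδ : (w 0).1 * (w 1).2 - (w 0).2 * (w 1).1 ≠ 0 := by
    intro h0
    have h1 : wedge (e 0) (e 1) = 0 := by
      rw [← he.tangent_zero, ← he.tangent_one, fderiv_apply_eq_dx_dy Ξ q (w 0),
        fderiv_apply_eq_dx_dy Ξ q (w 1), wedge_lin, h0, zero_smul]
    have h2 := norm_wedge_sq (e 0) (e 1)
    rw [h1, he.orthonormal.1, he.orthonormal.1, he.orthonormal.2 (by decide)] at h2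
    norm_num at h2
  refine ⟨(W.1 * (w 1).2 - W.2 * (w 1).1) / ((w 0).1 * (w 1).2 - (w 0).2 * (w 1).1),
    ((w 0).1 * W.2 - (w 0).2 * W.1) / ((w 0).1 * (w 1).2 - (w 0).2 * (w 1).1), ?_⟩
  ext
  · simp only [Prod.fst_add, Prod.smul_fst, smul_eq_mul]
    rw [div_mul_eq_mul_div, div_mul_eq_mul_div, ← add_div, eq_div_iff hδ]
    ring
  · simp only [Prod.snd_add, Prod.smul_snd, smul_eq_mul]
    rw [div_mul_eq_mul_div, div_mul_eq_mul_div, ← add_div, eq_div_iff hδ]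
    ring

/-- In a direction in which the second component of the Gauss map is stationary, the anti-self-dual
part of the derivative of `e₀ ∧ e₁` is a multiple of that of `e₀ ∧ e₁`. -/
lemma IsAdaptedFrame.exists_kleinB_eq_smul (h : IsImmersedOn Ξ U) (hq : q ∈ U) {e : Fin 4 → R4}
    {w : Fin 2 → ℝ × ℝ} (he : IsAdaptedFrame Ξ q e w) {W : ℝ × ℝ}
    (hb : fderiv ℝ (gauss₂ Ξ) q W = 0) :
    ∃ r : ℝ, kleinB (wedge (fderiv ℝ (fderiv ℝ Ξ) q W (w 0)) (e 1) +
      wedge (e 0) (fderiv ℝ (fderiv ℝ Ξ) q W (w 1))) = r • kleinB (wedge (e 0) (e 1)) := by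
  set δ := (w 0).1 * (w 1).2 - (w 0).2 * (w 1).1 with hδ
  have hwedge : ∀ p, wedge (fderiv ℝ Ξ p (w 0)) (fderiv ℝ Ξ p (w 1)) =
      δ • wedge (dx Ξ p) (dy Ξ p) := by
    intro p
    rw [fderiv_apply_eq_dx_dy Ξ p (w 0), fderiv_apply_eq_dx_dy Ξ p (w 1), wedge_lin]
  set γ : ℝ → ℝ × ℝ := fun t => q + t • W with hγ
  have hγ0 : γ 0 = q := by simp [hγ]
  have hγ' : HasDerivAt γ W 0 := by
    have h := ((hasDerivAt_id (0 : ℝ)).smul_const W).const_add q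
    rwa [one_smul] at h
  have hcomp : ∀ {F : Type} [NormedAddCommGroup F] [NormedSpace ℝ F] {f : ℝ × ℝ → F},
      DifferentiableAt ℝ f q → HasDerivAt (f ∘ γ) (fderiv ℝ f q W) 0 := by
    intro F _ _ f hf
    refine HasFDerivAt.comp_hasDerivAt 0 ?_ hγ'
    rw [hγ0]
    exact hf.hasFDerivAt
  have hγU : ∀ᶠ t in 𝓝 (0 : ℝ), γ t ∈ U := by
    refine hγ'.continuousAt.eventually ?_
    rw [hγ0]
    exact h.isOpen.mem_nhds hq
  have hD := hcomp (h.differentiableAt_fderiv hq)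
  have hl := kleinBL.hasFDerivAt.comp_hasDerivAt 0 ((wedgeBilin.hasFDerivAt.comp_hasDerivAt 0
    (hD.clm_apply (hasDerivAt_const 0 (w 0)))).clm_apply (hD.clm_apply (hasDerivAt_const 0 (w 1))))
  have hr := (((hcomp ((h.contDiffAt_norm_wedge hq).differentiableAt (by simp))).const_mul δ).smul
    (hcomp ((h.contDiffAt_gauss₂ hq).differentiableAt (by simp))))
  have hsplit : ∀ p ∈ U, kleinB (wedge (fderiv ℝ Ξ p (w 0)) (fderiv ℝ Ξ p (w 1))) =
      (δ * ‖wedge (dx Ξ p) (dy Ξ p)‖) • gauss₂ Ξ p := by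
    intro p hp
    rw [hwedge, ← h.norm_smul_gaussMap hp, smul_smul]
    simp only [h.norm_smul_gaussMap hp]
    exact kleinBL.map_smul _ _
  have heq := hl.unique (hr.congr_of_eventuallyEq (by
    filter_upwards [hγU] with t ht using hsplit _ ht))
  have hq' := hsplit q hq
  rw [he.tangent_zero, he.tangent_one] at hq'
  have hi := orthonormal_iff_ite.mp he.orthonormal
  have hne : δ * ‖wedge (dx Ξ q) (dy Ξ q)‖ ≠ 0 := by
    intro h0
    have h1 := inner_kleinB_wedge_left (e 0) (e 1) (e 1)
    rw [hq', h0] at h1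
    simp only [hi] at h1
    norm_num at h1
  simp only [Function.comp_apply, hγ0, hb, map_zero, add_zero, smul_zero, zero_add,
    he.tangent_zero, he.tangent_one, wedgeBilin_apply] at heq
  refine ⟨δ * fderiv ℝ (fun p => ‖wedge (dx Ξ p) (dy Ξ p)‖) q W *
    (δ * ‖wedge (dx Ξ q) (dy Ξ q)‖)⁻¹, ?_⟩
  rw [hq', mul_smul, inv_smul_smul₀ hne]
  exact heq

/-- `K - κ` is, up to sign, the Jacobian of the second component of the Gauss map, so `K = κ` where
that component is stationary in some direction. -/
theorem gaussCurvature_eq_normalCurvature (h : IsImmersedOn Ξ U) (hq : q ∈ U) {W : ℝ × ℝ}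
    (hW : W ≠ 0) (hb : fderiv ℝ (gauss₂ Ξ) q W = 0) {e : Fin 4 → R4} {w : Fin 2 → ℝ × ℝ}
    (he : IsAdaptedFrame Ξ q e w) :
    gaussCurvature Ξ q e w = normalCurvature Ξ q e w := by
  have hi := orthonormal_iff_ite.mp he.orthonormal
  obtain ⟨r, hr⟩ := he.exists_kleinB_eq_smul h hq hb
  obtain ⟨h2, h3⟩ := kleinB_wedge_perm he.orthonormal he.positive
  rw [← kleinB_neg, ← wedge_swap] at h2 h3
  have hadd : ∀ P Q, kleinB (P + Q) = kleinB P + kleinB Q := kleinBL.map_add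
  -- the two components of the derivative that are tangent to the sphere
  have e2 := congrArg (inner ℝ (kleinB (wedge (e 0) (e 2)))) hr
  have e3 := congrArg (inner ℝ (kleinB (wedge (e 0) (e 3)))) hr
  rw [hadd, inner_add_right, inner_smul_right, inner_kleinB_wedge_left, inner_kleinB_wedge_left]
    at e2 e3
  rw [h2, wedge_swap, kleinB_neg, inner_neg_left, inner_kleinB_wedge_right] at e2
  rw [h3, inner_kleinB_wedge_right] at e3
  simp only [hi] at e2 e3
  norm_num [Fin.ext_iff] at e2 e3
  obtain ⟨l, m, hlm⟩ := he.exists_eq_smul_add_smul W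
  have hsymm : fderiv ℝ (fderiv ℝ Ξ) q (w 1) (w 0) = fderiv ℝ (fderiv ℝ Ξ) q (w 0) (w 1) :=
    ((h.contDiffAt hq).isSymmSndFDerivAt (by simpa using ENat.LEInfty.out)).eq _ _
  have hne : l ≠ 0 ∨ m ≠ 0 := by
    by_contra! h0
    exact hW (by rw [hlm, h0.1, h0.2]; simp)
  rw [hlm] at e2 e3
  simp only [map_add, map_smul, add_apply, smul_apply,
    hsymm, inner_add_left, real_inner_smul_left, real_inner_comm _ (e 2), real_inner_comm _ (e 3)]
    at e2 e3
  unfold gaussCurvature normalCurvature sff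
  -- a nontrivial solution of the two linear equations makes their determinant vanish
  rcases hne with hl | hm
  · refine sub_eq_zero.mp ((mul_eq_zero.mp ?_).resolve_left hl)
    linear_combination (-(inner ℝ (fderiv ℝ (fderiv ℝ Ξ) q (w 1) (w 1)) (e 3) +
      inner ℝ (fderiv ℝ (fderiv ℝ Ξ) q (w 0) (w 1)) (e 2))) * e2 +
      (inner ℝ (fderiv ℝ (fderiv ℝ Ξ) q (w 1) (w 1)) (e 2) -
      inner ℝ (fderiv ℝ (fderiv ℝ Ξ) q (w 0) (w 1)) (e 3)) * e3
  · refine sub_eq_zero.mp ((mul_eq_zero.mp ?_).resolve_left hm)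
    linear_combination (inner ℝ (fderiv ℝ (fderiv ℝ Ξ) q (w 0) (w 1)) (e 3) +
      inner ℝ (fderiv ℝ (fderiv ℝ Ξ) q (w 0) (w 0)) (e 2)) * e2 -
      (inner ℝ (fderiv ℝ (fderiv ℝ Ξ) q (w 0) (w 1)) (e 2) -
      inner ℝ (fderiv ℝ (fderiv ℝ Ξ) q (w 0) (w 0)) (e 3)) * e3

end

/-! ### L-surfaces -/

lemma inner_eq_inner_klein (n P : R6) : inner ℝ n P =
    inner ℝ (kleinA n) (kleinA P) / 2 + inner ℝ (kleinB n) (kleinB P) / 2 := by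
  rw [inner_R3, inner_R3]
  simp [PiLp.inner_apply, Fin.sum_univ_succ, kleinA, kleinB]
  ring

/-- The complex structure `J` with `⟨J v, w⟩ = sympl v w`. -/
noncomputable def symplJ (v : R4) : R4 := !₂[-v 2, -v 3, v 0, v 1]

lemma inner_symplJ (v w : R4) : inner ℝ (symplJ v) w = sympl v w := by
  rw [inner_R4]; simp [symplJ, sympl]; ring

lemma inner_symplJ_symplJ (v w : R4) : inner ℝ (symplJ v) (symplJ w) = inner ℝ v w := by
  rw [inner_R4, inner_R4]; simp [symplJ]; ring

lemma sympl_swap (v w : R4) : sympl w v = -sympl v w := by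
  simp only [sympl]; ring

/-- A skew orthogonal matrix of size four is self-dual or anti-self-dual. -/
lemma skew_orthogonal_dual {N : Fin 4 → Fin 4 → ℝ} (hskew : ∀ i j, N j i = -N i j)
    (horth : ∀ i k, ∑ j, N i j * N k j = if i = k then 1 else 0) :
    (N 0 1 + N 2 3 = 0 ∧ N 0 2 + N 3 1 = 0 ∧ N 0 3 + N 1 2 = 0) ∨
      (N 0 1 - N 2 3 = 0 ∧ N 0 2 - N 3 1 = 0 ∧ N 0 3 - N 1 2 = 0) := by
  have hd : ∀ i, N i i = 0 := fun i => by linarith [hskew i i]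
  have h00 := horth 0 0
  have h11 := horth 1 1
  have h22 := horth 2 2
  have h33 := horth 3 3
  have h01 := horth 0 1
  have h02 := horth 0 2
  have h03 := horth 0 3
  have h12 := horth 1 2
  have h13 := horth 1 3
  have h23 := horth 2 3
  simp only [Fin.sum_univ_four, hd, hskew 0 1, hskew 0 2, hskew 0 3, hskew 2 3, hskew 3 1,
    hskew 1 2] at h00 h11 h22 h33 h01 h02 h03 h12 h13 h23
  norm_num [Fin.ext_iff] at h00 h11 h22 h33 h01 h02 h03 h12 h13 h23
  generalize N 0 1 = a at *
  generalize N 0 2 = b at *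
  generalize N 0 3 = c at *
  generalize N 2 3 = d at *
  generalize N 3 1 = e at *
  generalize N 1 2 = f at *
  -- the entries of `N Nᵀ - 1` contain all products of a self-dual and an anti-self-dual coordinate
  have m1 : (a + d) * (a - d) = 0 := by linarith
  have m2 : (a + d) * (b - e) = 0 := by linarith
  have m3 : (a + d) * (c - f) = 0 := by linarith
  have m4 : (b + e) * (a - d) = 0 := by linarith
  have m5 : (b + e) * (b - e) = 0 := by linarith
  have m6 : (b + e) * (c - f) = 0 := by linarith
  have m7 : (c + f) * (a - d) = 0 := by linarith
  have m8 : (c + f) * (b - e) = 0 := by linarith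
  have m9 : (c + f) * (c - f) = 0 := by linarith
  have hcancel : ∀ {s t : ℝ}, s ≠ 0 → s * t = 0 → t = 0 :=
    fun hs h => (mul_eq_zero.mp h).resolve_left hs
  by_cases ha : a + d = 0
  · by_cases hb : b + e = 0
    · by_cases hc : c + f = 0
      · exact Or.inl ⟨ha, hb, hc⟩
      · exact Or.inr ⟨hcancel hc m7, hcancel hc m8, hcancel hc m9⟩
    · exact Or.inr ⟨hcancel hb m4, hcancel hb m5, hcancel hb m6⟩
  · exact Or.inr ⟨hcancel ha m1, hcancel ha m2, hcancel ha m3⟩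

/-- The pull-back of the symplectic form by a linear isometry is given by a bivector which is
self-dual or anti-self-dual. -/
lemma exists_bivector_sympl_comp (A : R4 ≃ₗᵢ[ℝ] R4) :
    ∃ n : R6, n ≠ 0 ∧ (kleinA n = 0 ∨ kleinB n = 0) ∧
      ∀ v w, sympl (A v) (A w) = inner ℝ n (wedge v w) := by
  set c := (EuclideanSpace.basisFun (Fin 4) ℝ).map A with hc
  set N : Fin 4 → Fin 4 → ℝ := fun i j => sympl (c i) (c j) with hN
  have hskew : ∀ i j, N j i = -N i j := fun i j => sympl_swap _ _
  have horth : ∀ i k, ∑ j, N i j * N k j = if i = k then 1 else 0 := by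
    intro i k
    have h := c.sum_inner_mul_inner (symplJ (c i)) (symplJ (c k))
    rw [inner_symplJ_symplJ, orthonormal_iff_ite.mp c.orthonormal i k] at h
    rw [← h]
    refine Finset.sum_congr rfl fun j _ => ?_
    rw [real_inner_comm (symplJ (c k)) (c j), inner_symplJ, inner_symplJ]
  have hexp : ∀ v, A v = ∑ i, v i • c i := by
    intro v
    conv_lhs => rw [← (EuclideanSpace.basisFun (Fin 4) ℝ).sum_repr v]
    simp [hc]
  have hdual := skew_orthogonal_dual hskew horth
  have h00 := horth 0 0
  have hd : ∀ i, N i i = 0 := fun i => by linarith [hskew i i]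
  refine ⟨!₂[N 0 1, N 0 2, N 0 3, N 2 3, N 3 1, N 1 2], ?_, ?_, ?_⟩
  · intro h0
    have h1 : N 0 1 = 0 := by simpa using congrArg (fun P : R6 => P 0) h0
    have h2 : N 0 2 = 0 := by simpa using congrArg (fun P : R6 => P 1) h0
    have h3 : N 0 3 = 0 := by simpa using congrArg (fun P : R6 => P 2) h0
    simp [Fin.sum_univ_four, hd, h1, h2, h3] at h00
  · refine hdual.imp ?_ ?_
    · rintro ⟨h1, h2, h3⟩
      ext i; fin_cases i <;> simp [kleinA, h1, h2, h3]
    · rintro ⟨h1, h2, h3⟩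
      ext i; fin_cases i <;> simp [kleinB, h1, h2, h3]
  · intro v w
    rw [hexp v, hexp w]
    simp [PiLp.inner_apply, Fin.sum_univ_succ, wedge, hN, sympl]
    ring

/-- The tangent planes of a graph congruent to a Lagrangean surface are isotropic for the
pulled-back symplectic form: a graph is embedded, so every other immersion onto it has the same
tangent planes. -/
lemma exists_linearIsometry_of_isLSurface {φ ψ : ℝ × ℝ → ℝ} {U : Set (ℝ × ℝ)}
    (h : IsImmersedOn (graphMap φ ψ) U) (hL : IsLSurface (graphMap φ ψ '' U)) :
    ∃ A : R4 ≃ₗᵢ[ℝ] R4, ∀ q ∈ U, ∀ w₁ w₂ : ℝ × ℝ,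
      sympl (A (fderiv ℝ (graphMap φ ψ) q w₁)) (A (fderiv ℝ (graphMap φ ψ) q w₂)) = 0 := by
  obtain ⟨A, V, Λ, hΛ, himg, hsym⟩ := hL
  refine ⟨A.linearIsometryEquiv, fun q hq w₁ w₂ => ?_⟩
  have hlin : ∀ (B : R4 ≃ᵃⁱ[ℝ] R4) (x : R4), B x = B.linearIsometryEquiv x + B 0 := by
    intro B x
    simpa using B.map_vadd 0 x
  have hder : ∀ (B : R4 ≃ᵃⁱ[ℝ] R4) (x : R4), HasFDerivAt B
      (B.linearIsometryEquiv.toContinuousLinearEquiv : R4 →L[ℝ] R4) x := by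
    intro B x
    have h1 := (B.linearIsometryEquiv.toContinuousLinearEquiv : R4 →L[ℝ] R4).hasFDerivAt
      (x := x) |>.add_const (B 0)
    refine h1.congr_of_eventuallyEq (Filter.Eventually.of_forall fun y => ?_)
    exact hlin B y
  set π : R4 →L[ℝ] ℝ × ℝ :=
    (EuclideanSpace.proj 0 : R4 →L[ℝ] ℝ).prod (EuclideanSpace.proj 1 : R4 →L[ℝ] ℝ) with hπ
  have hπΞ : ∀ p, π (graphMap φ ψ p) = p := fun p => rfl
  set ρ : ℝ × ℝ → ℝ × ℝ := fun v => π (A.symm (Λ v)) with hρ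
  have hfac : ∀ v ∈ V, Λ v = A (graphMap φ ψ (ρ v)) := by
    intro v hv
    have hmem : Λ v ∈ A '' (graphMap φ ψ '' U) := himg ▸ ⟨v, hv, rfl⟩
    obtain ⟨-, ⟨p, hp, rfl⟩, hx⟩ := hmem
    simp only [hρ]
    rw [← hx, A.symm_apply_apply, hπΞ]
  obtain ⟨v, hv, hvq⟩ : A (graphMap φ ψ q) ∈ Λ '' V := himg ▸ ⟨_, ⟨q, hq, rfl⟩, rfl⟩
  have hρv : ρ v = q := by
    simp only [hρ]
    rw [hvq, A.symm_apply_apply, hπΞ]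
  have hdΛ := ((hΛ.contDiffAt hv).differentiableAt (by simp)).hasFDerivAt
  have hdρ : HasFDerivAt ρ (fderiv ℝ ρ v) v :=
    (π.differentiableAt.comp v ((hder A.symm _).differentiableAt.comp v
      hdΛ.differentiableAt)).hasFDerivAt
  have hdΞ : HasFDerivAt (graphMap φ ψ) (fderiv ℝ (graphMap φ ψ) q) (ρ v) := by
    rw [hρv]
    exact ((h.contDiffAt hq).differentiableAt (by simp)).hasFDerivAt
  have hchain : fderiv ℝ Λ v = (A.linearIsometryEquiv.toContinuousLinearEquiv : R4 →L[ℝ] R4).comp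
      ((fderiv ℝ (graphMap φ ψ) q).comp (fderiv ℝ ρ v)) := by
    refine hdΛ.unique ?_
    refine ((hder A _).comp v (hdΞ.comp v hdρ)).congr_of_eventuallyEq ?_
    filter_upwards [hΛ.isOpen.mem_nhds hv] with v' hv' using hfac v' hv'
  have hinj : Function.Injective (fderiv ℝ ρ v) := by
    have h1 := hΛ.immersion v hv
    rw [hchain] at h1
    exact fun x y hxy => h1 (by simp [hxy])
  have hsurj : Function.Surjective (fderiv ℝ ρ v) :=
    LinearMap.injective_iff_surjective (f := (fderiv ℝ ρ v).toLinearMap) |>.mp hinj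
  obtain ⟨y₁, rfl⟩ := hsurj w₁
  obtain ⟨y₂, rfl⟩ := hsurj w₂
  have h2 := hsym v hv y₁ y₂
  rw [hchain] at h2
  exact h2

/-- One of the two spherical images of an L-surface lies on a great circle. -/
theorem inGreatCircle_of_isLSurface {φ ψ : ℝ × ℝ → ℝ} {U : Set (ℝ × ℝ)}
    (h : IsImmersedOn (graphMap φ ψ) U) (hL : IsLSurface (graphMap φ ψ '' U)) :
    InGreatCircle (gauss₁ (graphMap φ ψ) '' U) ∨ InGreatCircle (gauss₂ (graphMap φ ψ) '' U) := by
  obtain ⟨A, hA⟩ := exists_linearIsometry_of_isLSurface h hL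
  obtain ⟨n, hn, hdual, hform⟩ := exists_bivector_sympl_comp A
  have hz : ∀ q ∈ U, inner ℝ n (gaussMap (graphMap φ ψ) q) = 0 := by
    intro q hq
    have h1 := hA q hq (1, 0) (0, 1)
    rw [hform] at h1
    rw [gaussMap, inner_smul_right]
    exact mul_eq_zero_of_right _ h1
  have hn' : ofKleinA (kleinA n) + ofKleinB (kleinB n) ≠ 0 := by rwa [ofKlein_klein]
  rcases hdual with h0 | h0
  · refine Or.inr ⟨kleinB n, fun h1 => hn' (by rw [h0, h1, map_zero, map_zero, add_zero]), ?_⟩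
    rintro _ ⟨q, hq, rfl⟩
    have h1 := hz q hq
    rw [inner_eq_inner_klein, h0, inner_zero_left] at h1
    simpa [gauss₂] using h1
  · refine Or.inl ⟨kleinA n, fun h1 => hn' (by rw [h0, h1, map_zero, map_zero, add_zero]), ?_⟩
    rintro _ ⟨q, hq, rfl⟩
    have h1 := hz q hq
    rw [inner_eq_inner_klein, h0, inner_zero_left] at h1
    simpa [gauss₁] using h1

/-! ### The graph of a solution -/

lemma IsImmersedOn.of_contDiffOn {φ ψ : ℝ × ℝ → ℝ} {U : Set (ℝ × ℝ)} (hU : IsOpen U)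
    (hφ : ContDiffOn ℝ ∞ φ U) (hψ : ContDiffOn ℝ ∞ ψ U) : IsImmersedOn (graphMap φ ψ) U := by
  have hs : ContDiffOn ℝ ∞ (graphMap φ ψ) U := by
    refine contDiffOn_euclidean.mpr fun i => ?_
    fin_cases i
    · exact contDiffOn_fst
    · exact contDiffOn_snd
    · exact hφ
    · exact hψ
  refine ⟨hU, hs, fun q hq => ?_⟩
  have hd := ((hs.contDiffAt (hU.mem_nhds hq)).differentiableAt (by simp)).hasFDerivAt
  -- the projection to the plane of the variables is a left inverse
  set π : R4 →L[ℝ] ℝ × ℝ :=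
    (EuclideanSpace.proj 0 : R4 →L[ℝ] ℝ).prod (EuclideanSpace.proj 1 : R4 →L[ℝ] ℝ)
  have h1 : π.comp (fderiv ℝ (graphMap φ ψ) q) = ContinuousLinearMap.id ℝ (ℝ × ℝ) :=
    (π.hasFDerivAt.comp q hd).unique (hasFDerivAt_id q)
  exact Function.LeftInverse.injective (g := π) fun w => congrArg (fun L => L w) h1

lemma dx_dy_graphMap {φ ψ : ℝ × ℝ → ℝ} {q : ℝ × ℝ} (hφ : DifferentiableAt ℝ φ q)
    (hψ : DifferentiableAt ℝ ψ q) : dx (graphMap φ ψ) q = !₂[1, 0, dx φ q, dx ψ q] ∧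
      dy (graphMap φ ψ) q = !₂[0, 1, dy φ q, dy ψ q] := by
  have hd : DifferentiableAt ℝ (graphMap φ ψ) q := by
    refine differentiableAt_euclidean.mpr fun i => ?_
    fin_cases i
    · exact differentiableAt_fst
    · exact differentiableAt_snd
    · exact hφ
    · exact hψ
  have hc : ∀ i w, fderiv ℝ (graphMap φ ψ) q w i = fderiv ℝ (fun p => graphMap φ ψ p i) q w := by
    intro i w
    have h1 : HasFDerivAt (fun p => graphMap φ ψ p i)
        ((EuclideanSpace.proj i : R4 →L[ℝ] ℝ).comp (fderiv ℝ (graphMap φ ψ) q)) q :=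
      (EuclideanSpace.proj i : R4 →L[ℝ] ℝ).hasFDerivAt.comp q hd.hasFDerivAt
    rw [h1.fderiv]
    rfl
  constructor
  · ext i
    rw [dx, hc]
    fin_cases i
    · exact congrArg (fun L : (ℝ × ℝ) →L[ℝ] ℝ => L (1, 0)) fderiv_fst
    · exact congrArg (fun L : (ℝ × ℝ) →L[ℝ] ℝ => L (1, 0)) fderiv_snd
    · rfl
    · rfl
  · ext i
    rw [dy, hc]
    fin_cases i
    · exact congrArg (fun L : (ℝ × ℝ) →L[ℝ] ℝ => L (0, 1)) fderiv_fst
    · exact congrArg (fun L : (ℝ × ℝ) →L[ℝ] ℝ => L (0, 1)) fderiv_snd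
    · rfl
    · rfl

lemma contDiff_halfSq : ContDiff ℝ ∞ halfSq := by
  unfold halfSq
  fun_prop

lemma dx_dy_halfSq (q : ℝ × ℝ) : dx halfSq q = q.1 ∧ dy halfSq q = q.2 := by
  have h : HasFDerivAt halfSq (q.1 • ContinuousLinearMap.fst ℝ ℝ ℝ +
      q.2 • ContinuousLinearMap.snd ℝ ℝ ℝ) q := by
    have h1 := (((hasFDerivAt_fst (𝕜 := ℝ) (p := q)).pow 2).add
      ((hasFDerivAt_snd (𝕜 := ℝ) (p := q)).pow 2)).mul_const (1 / 2 : ℝ)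
    refine (h1.congr_fderiv ?_).congr_of_eventuallyEq (Filter.Eventually.of_forall fun p => ?_)
    · ext <;> simp
    · simp [halfSq]; ring
  simp [dx, dy, h.fderiv]

/-- The angular derivative `x φ_y - y φ_x`. -/
noncomputable def angDeriv (φ : ℝ × ℝ → ℝ) (z : ℝ × ℝ) : ℝ := z.1 * dy φ z - z.2 * dx φ z

namespace IsSolutionGerm

variable {φ : ℝ × ℝ → ℝ}

lemma contDiffAt_dx (h : IsSolutionGerm φ) : ContDiffAt ℝ ω (dx φ) 0 :=
  (h.contDiffAt.fderiv_right (m := ω) (by simp)).clm_apply contDiffAt_const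

lemma contDiffAt_dy (h : IsSolutionGerm φ) : ContDiffAt ℝ ω (dy φ) 0 :=
  (h.contDiffAt.fderiv_right (m := ω) (by simp)).clm_apply contDiffAt_const

lemma dx_axis (h : IsSolutionGerm φ) : ∀ᶠ x in 𝓝 (0 : ℝ), dx φ (x, 0) = -x := by
  have hc : ContinuousAt (fun x : ℝ => (x, (0 : ℝ))) 0 := by fun_prop
  filter_upwards [h.initial.eventually_nhds, hc.eventually (h.contDiffAt.eventually (by simp))]
    with x hx hd
  have h1 := hasDerivAt_slice_fst (hd.differentiableAt (by simp))
  have h2 : HasDerivAt (fun x : ℝ => -x ^ 2 / 2) (-(2 * x) / 2) x := by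
    simpa using (((hasDerivAt_id x).pow 2).neg.div_const 2)
  rw [h1.unique (h2.congr_of_eventuallyEq hx)]
  ring

lemma dx_zero (h : IsSolutionGerm φ) : dx φ 0 = 0 := by
  have := h.dx_axis.self_of_nhds
  rwa [neg_zero] at this

/-- The second derivatives `φ_xy = 2`, `φ_yy = 0` come from differentiating the equation. -/
lemma hasFDerivAt_dy (h : IsSolutionGerm φ) :
    HasFDerivAt (dy φ) ((2 : ℝ) • ContinuousLinearMap.fst ℝ ℝ ℝ) 0 := by
  have hp := (h.contDiffAt_dx.differentiableAt (by simp)).hasFDerivAt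
  have hq := (h.contDiffAt_dy.differentiableAt (by simp)).hasFDerivAt
  have hx : HasFDerivAt (fun z : ℝ × ℝ => z.1) (ContinuousLinearMap.fst ℝ ℝ ℝ) 0 := hasFDerivAt_fst
  have hy : HasFDerivAt (fun z : ℝ × ℝ => z.2) (ContinuousLinearMap.snd ℝ ℝ ℝ) 0 := hasFDerivAt_snd
  have hm := (hx.mul hq).sub (hy.mul hp)
  have hl := (((hp.pow 2).add (hq.pow 2)).add (hx.pow 2)).add (hy.pow 2)
  have hr := ((hm.const_mul 4).const_add 1).add (hm.pow 2)
  have he := hl.unique (hr.congr_of_eventuallyEq h.equation)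
  refine hq.congr_fderiv ?_
  refine ContinuousLinearMap.ext fun w => ?_
  have hw := congrArg (fun L : (ℝ × ℝ) →L[ℝ] ℝ => L w) he
  simp [h.dx_zero, h.dy_zero] at hw
  simp
  linarith

lemma hasFDerivAt_dx (h : IsSolutionGerm φ) : HasFDerivAt (dx φ)
    (-ContinuousLinearMap.fst ℝ ℝ ℝ + (2 : ℝ) • ContinuousLinearMap.snd ℝ ℝ ℝ) 0 := by
  have hd := h.contDiffAt_dx.differentiableAt (by simp)
  have hD : DifferentiableAt ℝ (fderiv ℝ φ) 0 :=
    (h.contDiffAt.fderiv_right (m := ω) (by simp)).differentiableAt (by simp)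
  have happ : ∀ v w, fderiv ℝ (fun z => fderiv ℝ φ z v) 0 w = fderiv ℝ (fderiv ℝ φ) 0 w v := by
    intro v w
    rw [(hD.hasFDerivAt.clm_apply (hasFDerivAt_const v 0)).fderiv]
    simp
  have hxx : dx (dx φ) 0 = -1 :=
    (hasDerivAt_slice_fst hd).unique
      ((hasDerivAt_id (0 : ℝ)).neg.congr_of_eventuallyEq h.dx_axis)
  have hxy : dy (dx φ) 0 = 2 := by
    have h1 : dy (dx φ) 0 = dx (dy φ) 0 := by
      have hs : IsSymmSndFDerivAt ℝ φ 0 := h.contDiffAt.isSymmSndFDerivAt (by simp)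
      exact (happ _ _).trans ((hs.eq _ _).trans (happ _ _).symm)
    rw [h1, dx, h.hasFDerivAt_dy.fderiv]
    simp
  refine hd.hasFDerivAt.congr_fderiv ?_
  refine ContinuousLinearMap.ext fun w => ?_
  rw [fderiv_apply_eq_dx_dy, hxx, hxy]
  simp
  ring

lemma hasFDerivAt_angDeriv (h : IsSolutionGerm φ) :
    HasFDerivAt (angDeriv φ) (-ContinuousLinearMap.fst ℝ ℝ ℝ) 0 := by
  have hx : HasFDerivAt (fun z : ℝ × ℝ => z.1) (ContinuousLinearMap.fst ℝ ℝ ℝ) 0 := hasFDerivAt_fst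
  have hy : HasFDerivAt (fun z : ℝ × ℝ => z.2) (ContinuousLinearMap.snd ℝ ℝ ℝ) 0 := hasFDerivAt_snd
  refine ((hx.mul h.hasFDerivAt_dy).sub (hy.mul h.hasFDerivAt_dx)).congr_fderiv ?_
  ext <;> simp [h.dx_zero, h.dy_zero]

lemma eventually_pos (h : IsSolutionGerm φ) : ∀ᶠ z in 𝓝 (0 : ℝ × ℝ), 0 < 1 + angDeriv φ z := by
  have hc : ContinuousAt (fun z => 1 + angDeriv φ z) 0 :=
    continuousAt_const.add h.hasFDerivAt_angDeriv.continuousAt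
  exact hc.eventually_const_lt (by simp [angDeriv])

end IsSolutionGerm

/-- The spherical components of the Gauss map of the graph, up to the norm of `Ξ_x ∧ Ξ_y`, which by
the equation is `√2 (1 + x φ_y - y φ_x)`. -/
lemma gauss_graphMap {φ : ℝ × ℝ → ℝ} {z : ℝ × ℝ} (hφ : DifferentiableAt ℝ φ z)
    (heq : dx φ z ^ 2 + dy φ z ^ 2 + z.1 ^ 2 + z.2 ^ 2 =
      1 + 4 * angDeriv φ z + angDeriv φ z ^ 2) (hpos : 0 < 1 + angDeriv φ z) :
    (√2 * (1 + angDeriv φ z)) • gauss₁ (graphMap φ halfSq) z =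
        !₂[1 - angDeriv φ z, dy φ z + z.1, z.2 - dx φ z] ∧
      (√2 * (1 + angDeriv φ z)) • gauss₂ (graphMap φ halfSq) z =
        !₂[1 + angDeriv φ z, dy φ z - z.1, z.2 + dx φ z] := by
  obtain ⟨hx, hy⟩ := dx_dy_graphMap hφ (contDiff_halfSq.contDiffAt.differentiableAt (by simp) :
    DifferentiableAt ℝ halfSq z)
  rw [(dx_dy_halfSq z).1] at hx
  rw [(dx_dy_halfSq z).2] at hy
  have hw : wedge (dx (graphMap φ halfSq) z) (dy (graphMap φ halfSq) z) =
      !₂[1, dy φ z, z.2, -angDeriv φ z, z.1, -dx φ z] := by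
    rw [hx, hy]
    ext i; fin_cases i <;> simp [wedge, angDeriv]; ring
  have hn : ‖wedge (dx (graphMap φ halfSq) z) (dy (graphMap φ halfSq) z)‖ =
      √2 * (1 + angDeriv φ z) := by
    rw [← sq_eq_sq₀ (norm_nonneg _) (by positivity), norm_sq_R6, hw, mul_pow,
      Real.sq_sqrt (by norm_num)]
    simp
    linear_combination heq
  have hne : √2 * (1 + angDeriv φ z) ≠ 0 := by positivity
  have hG : (√2 * (1 + angDeriv φ z)) • gaussMap (graphMap φ halfSq) z =
      !₂[1, dy φ z, z.2, -angDeriv φ z, z.1, -dx φ z] := by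
    rw [gaussMap, hn, smul_inv_smul₀ hne, hw]
  constructor
  · refine (kleinAL.map_smul _ _).symm.trans ?_
    rw [hG]
    ext i; fin_cases i <;> simp [kleinAL_apply, kleinA] <;> ring
  · refine (kleinBL.map_smul _ _).symm.trans ?_
    rw [hG]
    ext i; fin_cases i <;> simp [kleinBL_apply, kleinB]

/-! ### The spherical images near the origin -/

namespace IsSolutionGerm

variable {φ : ℝ × ℝ → ℝ}

lemma eventually_smooth_and_equation (h : IsSolutionGerm φ) : ∀ᶠ z in 𝓝 (0 : ℝ × ℝ), ContDiffAt ℝ ω φ z ∧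
    (dx φ z ^ 2 + dy φ z ^ 2 + z.1 ^ 2 + z.2 ^ 2 =
      1 + 4 * angDeriv φ z + angDeriv φ z ^ 2) ∧ 0 < 1 + angDeriv φ z ∧
    φ (z.1, 0) = -z.1 ^ 2 / 2 := by
  have hf : Filter.Tendsto Prod.fst (𝓝 (0 : ℝ × ℝ)) (𝓝 (0 : ℝ)) := continuousAt_fst
  filter_upwards [h.contDiffAt.eventually (by simp), h.equation, h.eventually_pos,
    hf.eventually h.initial] with z h1 h2 h3 h4 using ⟨h1, h2, h3, h4⟩

lemma eventually_gauss (h : IsSolutionGerm φ) : ∀ᶠ z in 𝓝 (0 : ℝ × ℝ),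
    (√2 * (1 + angDeriv φ z)) • gauss₁ (graphMap φ halfSq) z =
        !₂[1 - angDeriv φ z, dy φ z + z.1, z.2 - dx φ z] ∧
      (√2 * (1 + angDeriv φ z)) • gauss₂ (graphMap φ halfSq) z =
        !₂[1 + angDeriv φ z, dy φ z - z.1, z.2 + dx φ z] := by
  filter_upwards [h.eventually_smooth_and_equation] with z ⟨h1, h2, h3, _⟩
  exact gauss_graphMap (h1.differentiableAt (by simp)) h2 h3

lemma angDeriv_zero : angDeriv φ 0 = 0 := by simp [angDeriv]

/-- The first spherical image is not contained in a great circle, since the value and the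
first derivatives at the origin span the space. -/
lemma not_inGreatCircle_gauss₁ (h : IsSolutionGerm φ) {U : Set (ℝ × ℝ)}
    (hU : U ∈ 𝓝 (0 : ℝ × ℝ)) : ¬ InGreatCircle (gauss₁ (graphMap φ halfSq) '' U) := by
  rintro ⟨n, hn, hz⟩
  have hx : HasFDerivAt (fun z : ℝ × ℝ => z.1) (ContinuousLinearMap.fst ℝ ℝ ℝ) 0 := hasFDerivAt_fst
  have hy : HasFDerivAt (fun z : ℝ × ℝ => z.2) (ContinuousLinearMap.snd ℝ ℝ ℝ) 0 := hasFDerivAt_snd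
  have he : (fun z => n 0 * (1 - angDeriv φ z) + n 1 * (dy φ z + z.1) + n 2 * (z.2 - dx φ z))
      =ᶠ[𝓝 (0 : ℝ × ℝ)] fun _ => 0 := by
    filter_upwards [hU, h.eventually_gauss] with z hzU ⟨h1, _⟩
    have h2 := real_inner_smul_right n (gauss₁ (graphMap φ halfSq) z)
      (√2 * (1 + angDeriv φ z))
    rw [h1, hz _ ⟨z, hzU, rfl⟩, inner_R3] at h2
    simpa using h2
  have h0 := he.self_of_nhds
  have hd := ((((h.hasFDerivAt_angDeriv.const_sub 1).const_mul (n 0)).add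
    ((h.hasFDerivAt_dy.add hx).const_mul (n 1))).add
    ((hy.sub h.hasFDerivAt_dx).const_mul (n 2))).unique
    ((hasFDerivAt_const 0 0).congr_of_eventuallyEq he)
  have hd1 := congrArg (fun L : (ℝ × ℝ) →L[ℝ] ℝ => L (1, 0)) hd
  have hd2 := congrArg (fun L : (ℝ × ℝ) →L[ℝ] ℝ => L (0, 1)) hd
  simp [h.dx_zero, h.dy_zero, angDeriv_zero] at h0 hd1 hd2
  norm_num at hd2
  refine hn ?_
  ext i
  fin_cases i
  · show n 0 = 0
    linarith
  · show n 1 = 0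
    linarith
  · show n 2 = 0
    linarith

/-- The second spherical image is not contained in a great circle: the only candidate is the one
tangent to the small circle at the value at the origin, and then the second component of the Gauss
map would be constant. -/
lemma not_inGreatCircle_gauss₂ (h : IsSolutionGerm φ) {U : Set (ℝ × ℝ)}
    (hU : U ∈ 𝓝 (0 : ℝ × ℝ)) : ¬ InGreatCircle (gauss₂ (graphMap φ halfSq) '' U) := by
  rintro ⟨n, hn, hz⟩
  have hx : HasFDerivAt (fun z : ℝ × ℝ => z.1) (ContinuousLinearMap.fst ℝ ℝ ℝ) 0 := hasFDerivAt_fst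
  have hy : HasFDerivAt (fun z : ℝ × ℝ => z.2) (ContinuousLinearMap.snd ℝ ℝ ℝ) 0 := hasFDerivAt_snd
  have he : (fun z => n 0 * (1 + angDeriv φ z) + n 1 * (dy φ z - z.1) + n 2 * (z.2 + dx φ z))
      =ᶠ[𝓝 (0 : ℝ × ℝ)] fun _ => 0 := by
    filter_upwards [hU, h.eventually_gauss] with z hzU ⟨_, h1⟩
    have h2 := real_inner_smul_right n (gauss₂ (graphMap φ halfSq) z)
      (√2 * (1 + angDeriv φ z))
    rw [h1, hz _ ⟨z, hzU, rfl⟩, inner_R3] at h2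
    simpa using h2
  have h0 := he.self_of_nhds
  have hd := ((((h.hasFDerivAt_angDeriv.const_add 1).const_mul (n 0)).add
    ((h.hasFDerivAt_dy.sub hx).const_mul (n 1))).add
    ((hy.add h.hasFDerivAt_dx).const_mul (n 2))).unique
    ((hasFDerivAt_const 0 0).congr_of_eventuallyEq he)
  have hd2 := congrArg (fun L : (ℝ × ℝ) →L[ℝ] ℝ => L (0, 1)) hd
  simp [h.dx_zero, h.dy_zero, angDeriv_zero] at h0 hd2
  have hn2 : n 2 = 0 := by linarith
  have hn1 : n 1 = n 0 := by linarith
  have hn0 : n 0 ≠ 0 := by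
    intro h3
    refine hn ?_
    ext i
    fin_cases i
    · exact h3
    · exact hn1.trans h3
    · exact hn2
  have hc : (fun z => z.2 + dx φ z) =ᶠ[𝓝 (0 : ℝ × ℝ)] fun _ => 0 := by
    filter_upwards [he, h.eventually_smooth_and_equation] with z h1 ⟨_, h2, _, _⟩
    rw [hn1, hn2] at h1
    have h3 : 1 + angDeriv φ z + (dy φ z - z.1) = 0 := by
      refine (mul_eq_zero.mp ?_).resolve_left hn0
      linear_combination h1
    have h4 : (z.2 + dx φ z) ^ 2 = 0 := by
      have h5 : angDeriv φ z = z.1 * dy φ z - z.2 * dx φ z := rfl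
      linear_combination h2 + (1 + angDeriv φ z - (dy φ z - z.1)) * h3 + 2 * h5
    exact pow_eq_zero_iff (two_ne_zero) |>.mp h4
  have hd3 := (hy.add h.hasFDerivAt_dx).unique ((hasFDerivAt_const 0 0).congr_of_eventuallyEq hc)
  have hd4 := congrArg (fun L : (ℝ × ℝ) →L[ℝ] ℝ => L (1, 0)) hd3
  simp at hd4

/-- By continuity it is enough to look at the origin, where the derivatives of `a₁` and `a₃` are
proportional to `w.1` and `w.1 - w.2`. -/
lemma eventually_injective_fderiv_gauss₁ (h : IsSolutionGerm φ) : ∀ᶠ z in 𝓝 (0 : ℝ × ℝ),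
    Function.Injective (fderiv ℝ (gauss₁ (graphMap φ halfSq)) z) := by
  have hx : HasFDerivAt (fun z : ℝ × ℝ => z.1) (ContinuousLinearMap.fst ℝ ℝ ℝ) 0 := hasFDerivAt_fst
  have hy : HasFDerivAt (fun z : ℝ × ℝ => z.2) (ContinuousLinearMap.snd ℝ ℝ ℝ) 0 := hasFDerivAt_snd
  obtain ⟨r, hr, hball⟩ := Metric.eventually_nhds_iff_ball.mp h.eventually_smooth_and_equation
  have himm : IsImmersedOn (graphMap φ halfSq) (Metric.ball 0 r) :=
    IsImmersedOn.of_contDiffOn Metric.isOpen_ball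
      (fun z hz => ((hball z hz).1.of_le le_top).contDiffWithinAt) contDiff_halfSq.contDiffOn
  have hg := himm.contDiffAt_gauss₁ (Metric.mem_ball_self hr)
  have hcont : ContinuousAt (fderiv ℝ (gauss₁ (graphMap φ halfSq))) 0 :=
    (hg.fderiv_right (m := 0) (by simp)).continuousAt
  refine hcont.eventually_mem (ContinuousLinearMap.isOpen_injective.mem_nhds ?_)
  refine (injective_iff_map_eq_zero _).mpr fun w hw => ?_
  have hd := (hg.differentiableAt (by simp)).hasFDerivAt
  have hcomp : ∀ i, HasFDerivAt (fun z => gauss₁ (graphMap φ halfSq) z i)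
      ((EuclideanSpace.proj i : R3 →L[ℝ] ℝ).comp (fderiv ℝ (gauss₁ (graphMap φ halfSq)) 0)) 0 :=
    fun i => (EuclideanSpace.proj i : R3 →L[ℝ] ℝ).hasFDerivAt.comp 0 hd
  -- differentiating the products avoids the derivative of the norm of `Ξ_x ∧ Ξ_y`
  have hmul := fun i => ((h.hasFDerivAt_angDeriv.const_add 1).const_mul √2).mul (hcomp i)
  have e0 : (fun z => √2 * (1 + angDeriv φ z) * gauss₁ (graphMap φ halfSq) z 0) =ᶠ[𝓝 0]
      fun z => 1 - angDeriv φ z := by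
    filter_upwards [h.eventually_gauss] with z ⟨h1, _⟩
    simpa using congrArg (fun v : R3 => v 0) h1
  have e2 : (fun z => √2 * (1 + angDeriv φ z) * gauss₁ (graphMap φ halfSq) z 2) =ᶠ[𝓝 0]
      fun z => z.2 - dx φ z := by
    filter_upwards [h.eventually_gauss] with z ⟨h1, _⟩
    simpa using congrArg (fun v : R3 => v 2) h1
  have d0 := (hmul 0).unique ((h.hasFDerivAt_angDeriv.const_sub 1).congr_of_eventuallyEq e0)
  have d2 := (hmul 2).unique ((hy.sub h.hasFDerivAt_dx).congr_of_eventuallyEq e2)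
  have d0' := congrArg (fun L : (ℝ × ℝ) →L[ℝ] ℝ => L w) d0
  have d2' := congrArg (fun L : (ℝ × ℝ) →L[ℝ] ℝ => L w) d2
  have v0 := e0.self_of_nhds
  have v2 := e2.self_of_nhds
  simp [hw, h.dx_zero, angDeriv_zero] at d0' d2' v0 v2
  have h2 : √2 ≠ 0 := by positivity
  have hw1 : w.1 = 0 := by
    linear_combination -d0' / 2 - w.1 / 2 * v0
  have hw2 : w.2 = 0 := by
    rw [v2] at d2'
    linear_combination hw1 + d2'
  exact Prod.ext hw1 hw2

end IsSolutionGerm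

end SurfR4

theorem mainTheorem3 :
    ∃ (U : Set (ℝ × ℝ)) (φ : ℝ × ℝ → ℝ),
      IsOpen U ∧ IsConnected U ∧ (0, 0) ∈ U ∧ ContDiffOn ℝ ∞ φ U ∧
      -- the partial differential equation and its initial condition
      (∀ q ∈ U, 1 - q.2 * SurfR4.dx φ q + q.1 * SurfR4.dy φ q =
        (1 / √2) * √(1 + SurfR4.dx φ q ^ 2 + SurfR4.dy φ q ^ 2 + q.1 ^ 2 + q.2 ^ 2 +
          (q.2 * SurfR4.dx φ q - q.1 * SurfR4.dy φ q) ^ 2)) ∧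
      (∀ x : ℝ, (x, 0) ∈ U → φ (x, 0) = -x ^ 2 / 2) ∧ SurfR4.dy φ (0, 0) = -1 ∧
      -- the graph is a surface, and its Gauss map
      SurfR4.IsImmersedOn (SurfR4.graphMap φ SurfR4.halfSq) U ∧
      SurfR4.gauss₂ (SurfR4.graphMap φ SurfR4.halfSq) '' U ⊆ SurfR4.sphereCircle (1 / √2) ∧
      (∀ q ∈ U, Function.Injective
        (fderiv ℝ (SurfR4.gauss₁ (SurfR4.graphMap φ SurfR4.halfSq)) q)) ∧
      ¬ SurfR4.InGreatCircle (SurfR4.gauss₁ (SurfR4.graphMap φ SurfR4.halfSq) '' U) ∧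
      ¬ SurfR4.InGreatCircle (SurfR4.gauss₂ (SurfR4.graphMap φ SurfR4.halfSq) '' U) ∧
      -- the Gaussian and the normal curvature coincide
      (∀ q ∈ U,
        (∃ e w, SurfR4.IsAdaptedFrame (SurfR4.graphMap φ SurfR4.halfSq) q e w) ∧
        ∀ e w, SurfR4.IsAdaptedFrame (SurfR4.graphMap φ SurfR4.halfSq) q e w →
          SurfR4.gaussCurvature (SurfR4.graphMap φ SurfR4.halfSq) q e w =
            SurfR4.normalCurvature (SurfR4.graphMap φ SurfR4.halfSq) q e w) ∧
      -- isoclinic, but not congruent to a Lagrangean surface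
      SurfR4.IsIsoclinicSurface (SurfR4.graphMap φ SurfR4.halfSq) U ∧
      ¬ SurfR4.IsLSurface (SurfR4.graphMap φ SurfR4.halfSq '' U) := by
  obtain ⟨φ, h⟩ := SurfR4.exists_isSolutionGerm
  obtain ⟨r, hr, hball⟩ := Metric.eventually_nhds_iff_ball.mp
    (h.eventually_smooth_and_equation.and h.eventually_injective_fderiv_gauss₁)
  have h0 : (0 : ℝ × ℝ) ∈ Metric.ball (0 : ℝ × ℝ) r := Metric.mem_ball_self hr
  have hU : Metric.ball (0 : ℝ × ℝ) r ∈ 𝓝 (0 : ℝ × ℝ) := Metric.ball_mem_nhds 0 hr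
  have hφ : ContDiffOn ℝ ∞ φ (Metric.ball 0 r) :=
    fun z hz => ((hball z hz).1.1.of_le le_top).contDiffWithinAt
  have himm : SurfR4.IsImmersedOn (SurfR4.graphMap φ SurfR4.halfSq) (Metric.ball 0 r) :=
    SurfR4.IsImmersedOn.of_contDiffOn Metric.isOpen_ball hφ SurfR4.contDiff_halfSq.contDiffOn
  have hcircle : SurfR4.gauss₂ (SurfR4.graphMap φ SurfR4.halfSq) '' Metric.ball 0 r ⊆
      SurfR4.sphereCircle (1 / √2) := by
    rintro _ ⟨z, hz, rfl⟩
    obtain ⟨⟨h1, h2, h3, -⟩, -⟩ := hball z hz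
    refine ⟨((SurfR4.mem_grassmannian_iff _).mp (himm.gaussMap_mem_grassmannian hz)).2, ?_⟩
    have h4 := congrArg (fun v : SurfR4.R3 => v 0)
      (SurfR4.gauss_graphMap (h1.differentiableAt (by simp)) h2 h3).2
    have h5 : √2 * (1 + SurfR4.angDeriv φ z) *
        SurfR4.gauss₂ (SurfR4.graphMap φ SurfR4.halfSq) z 0 = 1 + SurfR4.angDeriv φ z := by
      simpa using h4
    rw [eq_div_iff (by positivity)]
    refine mul_left_cancel₀ h3.ne' ?_
    linear_combination h5
  have hc : (1 / √2) ^ 2 < 1 := by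
    rw [div_pow, Real.sq_sqrt (by norm_num)]
    norm_num
  have hL₁ := h.not_inGreatCircle_gauss₁ hU
  have hL₂ := h.not_inGreatCircle_gauss₂ hU
  refine ⟨Metric.ball 0 r, φ, Metric.isOpen_ball,
    ⟨⟨0, h0⟩, (convex_ball (0 : ℝ × ℝ) r).isPreconnected⟩, h0, hφ, ?_, ?_, h.dy_zero, himm, hcircle,
    fun z hz => (hball z hz).2, hL₁, hL₂, ?_, ?_, ?_⟩
  · intro z hz
    obtain ⟨⟨-, h2, h3, -⟩, -⟩ := hball z hz
    have hm : SurfR4.angDeriv φ z = z.1 * SurfR4.dy φ z - z.2 * SurfR4.dx φ z := rfl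
    -- by the squared equation, the radicand is a perfect square
    have hrad : 1 + SurfR4.dx φ z ^ 2 + SurfR4.dy φ z ^ 2 + z.1 ^ 2 + z.2 ^ 2 +
        (z.2 * SurfR4.dx φ z - z.1 * SurfR4.dy φ z) ^ 2 = 2 * (1 + SurfR4.angDeriv φ z) ^ 2 := by
      rw [hm] at h2 ⊢
      linear_combination h2
    rw [hrad, Real.sqrt_mul (by norm_num), Real.sqrt_sq h3.le, ← mul_assoc,
      one_div_mul_cancel (by positivity), one_mul, hm]
    ring
  · intro x hx
    exact (hball _ hx).1.2.2.2
  · intro z hz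
    refine ⟨himm.exists_isAdaptedFrame hz, fun e w he => ?_⟩
    obtain ⟨W, hW, hb⟩ := SurfR4.exists_fderiv_gauss₂_eq_zero himm hc hcircle hz
    exact SurfR4.gaussCurvature_eq_normalCurvature himm hz hW hb he
  · intro z hz
    obtain ⟨W, hW, hb⟩ := SurfR4.exists_fderiv_gauss₂_eq_zero himm hc hcircle hz
    obtain ⟨u, hu⟩ := SurfR4.isIsoclinicDirection_of_fderiv_gauss₂_eq_zero himm hz hW hb
    exact ⟨u, Or.inr hu⟩
  · intro hL
    exact (SurfR4.inGreatCircle_of_isLSurface himm hL).elim hL₁ hL₂
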